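/- Let $(\tilde M,\varphi,\xi,\eta,g)$ be a Kenmotsu manifold, i.e. $g$ is a Riemannian metric, $\varphi$ a $(1,1)$-tensor field, $\xi$ a vector field and $\eta$ a $1$-form on $\tilde M$ with $\varphi^2=-I+\eta\otimes\xi$, $\varphi\xi=0$, $\eta\circ\varphi=0$, $\eta(\xi)=1$, $g(\varphi X,\varphi Y)=g(X,Y)-\eta(X)\eta(Y)$, and $(\tilde\nabla_X\varphi)Y=g(\varphi X,Y)\xi-\eta(Y)\varphi X$ for all vector fields $X,Y$, where $\tilde\nabla$ is the Levi-Civita connection of $g$. Let $(M_T,g_T)$ and $(M_\theta,g_\theta)$ be Riemannian manifolds, $\dim M_\theta=2s$, let $f$ be a smooth positive function on $M_T$, and let $M=M_T\times_f M_\theta$ be the warped product $(M_T\times M_\theta,\ g_T+f^2g_\theta)$, isometrically immersed in $\tilde M$. Assume that $M$ is a proper warped product semi-slant submanifold with $\xi$ tangent to $M_T$, i.e. - $M_T$ is an invariant submanifold tangent to $\xi$: for all $q\in M_\theta$ the tangent spaces of $M_T\times\{q\}$ contain $\xi$ and are mapped into themselves by $\varphi$; - $M_\theta$ is a proper slant submanifold: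 there is a constant $\theta\in(0,\pi/2)$ such that for every $p\in M_T$ and every nonzero vector $Z$ tangent to $\{p\}\times M_\theta$, the angle between $\varphi Z$ and the tangent space of $\{p\}\times M_\theta$ is $\theta$. Let $h$ be the second fundamental form of $M$ in $\tilde M$, $\|h\|^2=\sum_{i,j}g(h(e_i,e_j),h(e_i,e_j))$ for an orthonormal frame $(e_i)$ of $M$, and let $\nabla^T(\ln f)$ be the gradient of $\ln f$ on $M_T$. Then: (i) At every point of $M$, $$\|h\|^2\ \ge\ 4s\,(\csc^2\theta+\cot^2\theta)\,\bigl(\|\nabla^T(\ln f)\|^2-1\bigr).$$ (ii) If equality holds in (i) at every point of $M$, then $M_T$ is totally geodesic in $\tilde M$ (i.e. every $M_T\times\{q\}$ is), $M_\theta$ is totally umbilical in $\tilde M$ (i.e. every $\{p\}\times M_\theta$ is), and $M$ is minimal in $\tilde M$. -/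

import Mathlib

open Bundle
open scoped Manifold ContDiff

noncomputable section

namespace KenmotsuGeometry

/-- Tangent spaces of a finite-dimensional manifold are finite-dimensional. -/
instance tangentSpaceFiniteDimensional {F : Type*} [NormedAddCommGroup F] [NormedSpace ℝ F]
    [FiniteDimensional ℝ F] {H : Type*} [TopologicalSpace H] (J : ModelWithCorners ℝ F H)
    {N : Type*} [TopologicalSpace N] [ChartedSpace H N] (y : N) :
    FiniteDimensional ℝ (TangentSpace J y) :=
  inferInstanceAs (FiniteDimensional ℝ F)

/-! ### The Levi-Civita connection -/

section Connection

variable {F : Type*} [NormedAddCommGroup F] [NormedSpace ℝ F] [FiniteDimensional ℝ F]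
  {H : Type*} [TopologicalSpace H] (J : ModelWithCorners ℝ F H)
  {N : Type*} [TopologicalSpace N] [ChartedSpace H N] [IsManifold J ∞ N]
  [RiemannianBundle (fun y : N => TangentSpace J y)]

/-- The right-hand side of the Koszul formula for the coordinate vector fields `U`, `V`, `W`
(constant coefficients in the preferred chart at `y`, so that their brackets vanish near `y`) with
values `u`, `v`, `w` at `y`: `½ (u⟨V, W⟩ + v⟨U, W⟩ - w⟨U, V⟩)`. This is the Christoffel symbol of
the first kind of the metric in that chart. -/
def koszul (y : N) (u v w : TangentSpace J y) : ℝ :=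
  (1 / 2) *
    (mvfderiv J (fun z : N => inner ℝ (FiberBundle.extend F v z : TangentSpace J z)
        (FiberBundle.extend F w z : TangentSpace J z)) y u
      + mvfderiv J (fun z : N => inner ℝ (FiberBundle.extend F u z : TangentSpace J z)
        (FiberBundle.extend F w z : TangentSpace J z)) y v
      - mvfderiv J (fun z : N => inner ℝ (FiberBundle.extend F u z : TangentSpace J z)
        (FiberBundle.extend F v z : TangentSpace J z)) y w)

/-- The Christoffel symbol (of the second kind) `Γ(u, v)` at `y`, in the preferred chart at `y`:
the tangent vector characterized by `⟨Γ(u, v), w⟩ = koszul u v w` for all `w`, written out in an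
orthonormal basis. -/
def christoffel (y : N) (u v : TangentSpace J y) : TangentSpace J y :=
  ∑ i, koszul J y u v (stdOrthonormalBasis ℝ (TangentSpace J y) i) •
    stdOrthonormalBasis ℝ (TangentSpace J y) i

variable {E : Type*} [NormedAddCommGroup E] [NormedSpace ℝ E]
  {H' : Type*} [TopologicalSpace H'] (I : ModelWithCorners ℝ E H')
  {M : Type*} [TopologicalSpace M] [ChartedSpace H' M]

/-- The covariant derivative at `x`, in the direction `u`, of a vector field `σ` along the map
`ψ : M → N`, for the Levi-Civita connection of `N`. In the preferred chart at `ψ x` it is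
`∂_u σ + Γ(dψ u, σ)`. -/
def covariantDerivAlong (ψ : M → N) (σ : ∀ x : M, TangentSpace J (ψ x)) (x : M)
    (u : TangentSpace I x) : TangentSpace J (ψ x) :=
  (trivializationAt F (fun y : N => TangentSpace J y) (ψ x)).symm (ψ x)
      (mvfderiv I (fun z : M =>
        ((trivializationAt F (fun y : N => TangentSpace J y) (ψ x)) ⟨ψ z, σ z⟩).2) x u)
    + christoffel J (ψ x) (mfderiv I J ψ x u) (σ x)

/-- The Levi-Civita connection of `N`: the covariant derivative `∇_u Y` at `y` of a vector field
`Y` on `N`, i.e. of a vector field along the identity map. -/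
def leviCivita (Y : ∀ y : N, TangentSpace J y) (y : N) (u : TangentSpace J y) :
    TangentSpace J y :=
  covariantDerivAlong J J (fun z : N => z) Y y u

end Connection

/-! ### Almost contact metric manifolds and Kenmotsu manifolds -/

section Contact

variable {F : Type*} [NormedAddCommGroup F] [NormedSpace ℝ F] [FiniteDimensional ℝ F]
  {H : Type*} [TopologicalSpace H] (J : ModelWithCorners ℝ F H)
  {N : Type*} [TopologicalSpace N] [ChartedSpace H N] [IsManifold J ∞ N]
  [RiemannianBundle (fun y : N => TangentSpace J y)]

/-- `(φ, ξ, η)` together with the Riemannian metric of `N` is an almost contact metric structure. -/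
structure IsAlmostContactMetric (φ : ∀ y : N, TangentSpace J y →L[ℝ] TangentSpace J y)
    (ξ : ∀ y : N, TangentSpace J y) (η : ∀ y : N, TangentSpace J y →L[ℝ] ℝ) : Prop where
  smooth_phi : ContMDiff J (J.prod 𝓘(ℝ, F →L[ℝ] F)) ∞
    (fun y : N => (TotalSpace.mk' (F →L[ℝ] F) y (φ y) :
      TotalSpace (F →L[ℝ] F) (fun y : N => TangentSpace J y →L[ℝ] TangentSpace J y)))
  smooth_xi : ContMDiff J (J.prod 𝓘(ℝ, F)) ∞
    (fun y : N => (TotalSpace.mk' F y (ξ y) :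
      TotalSpace F (fun y : N => TangentSpace J y)))
  smooth_eta : ContMDiff J (J.prod 𝓘(ℝ, F →L[ℝ] ℝ)) ∞
    (fun y : N => (TotalSpace.mk' (F →L[ℝ] ℝ) y (η y) :
      TotalSpace (F →L[ℝ] ℝ)
        (fun y : N => TangentSpace J y →L[ℝ] Trivial N ℝ y)))
  phi_phi : ∀ (y : N) (v : TangentSpace J y), φ y (φ y v) = -v + η y v • ξ y
  phi_xi : ∀ y : N, φ y (ξ y) = 0
  eta_phi : ∀ (y : N) (v : TangentSpace J y), η y (φ y v) = 0
  eta_xi : ∀ y : N, η y (ξ y) = 1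
  inner_phi_phi : ∀ (y : N) (v w : TangentSpace J y),
    inner ℝ (φ y v) (φ y w) = inner ℝ v w - η y v * η y w

/-- A Kenmotsu manifold: an almost contact metric manifold with
`(∇_X φ) Y = g(φ X, Y) ξ - η(Y) φ X`, where `(∇_X φ) Y = ∇_X (φ Y) - φ (∇_X Y)` and `∇` is the
Levi-Civita connection. -/
structure IsKenmotsu (φ : ∀ y : N, TangentSpace J y →L[ℝ] TangentSpace J y)
    (ξ : ∀ y : N, TangentSpace J y) (η : ∀ y : N, TangentSpace J y →L[ℝ] ℝ) : Prop
    extends IsAlmostContactMetric J φ ξ η where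
  nabla_phi : ∀ (y : N) (X : TangentSpace J y) (Y : ∀ z : N, TangentSpace J z),
    ContMDiffAt J (J.prod 𝓘(ℝ, F)) ∞
      (fun z : N => (TotalSpace.mk' F z (Y z) :
        TotalSpace F (fun z : N => TangentSpace J z))) y →
    leviCivita J (fun z : N => φ z (Y z)) y X - φ y (leviCivita J Y y X) =
      (inner ℝ (φ y X) (Y y) : ℝ) • ξ y - η y (Y y) • φ y X

end Contact

/-! ### Extrinsic geometry of an immersed submanifold -/

section Submanifold

variable {F : Type*} [NormedAddCommGroup F] [NormedSpace ℝ F] [FiniteDimensional ℝ F]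
  {H : Type*} [TopologicalSpace H] (J : ModelWithCorners ℝ F H)
  {N : Type*} [TopologicalSpace N] [ChartedSpace H N] [IsManifold J ∞ N]
  [RiemannianBundle (fun y : N => TangentSpace J y)]
  {E : Type*} [NormedAddCommGroup E] [NormedSpace ℝ E]
  {H' : Type*} [TopologicalSpace H'] (I : ModelWithCorners ℝ E H')
  {M : Type*} [TopologicalSpace M] [ChartedSpace H' M]

/-- The tangent space of the submanifold `ψ : M → N` at `x`, as a subspace of the tangent space of
the ambient manifold at `ψ x`. -/
def tangentImage (ψ : M → N) (x : M) : Submodule ℝ (TangentSpace J (ψ x)) :=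
  LinearMap.range (mfderiv I J ψ x : TangentSpace I x →ₗ[ℝ] TangentSpace J (ψ x))

/-- The induced metric of the submanifold `ψ : M → N`. -/
def inducedMetric (ψ : M → N) (x : M) (u v : TangentSpace I x) : ℝ :=
  inner ℝ (mfderiv I J ψ x u) (mfderiv I J ψ x v)

/-- An orthonormal frame at `x` for the induced metric of the immersed submanifold `ψ : M → N`. -/
def orthonormalFrame (ψ : M → N) (x : M) (i : Fin (Module.finrank ℝ (tangentImage J I ψ x))) :
    TangentSpace I x :=
  (LinearMap.mem_range.1 (stdOrthonormalBasis ℝ (tangentImage J I ψ x) i).2).choose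

/-- The submanifold is invariant: `φ` maps its tangent spaces to themselves. -/
def IsInvariant (φ : ∀ y : N, TangentSpace J y →L[ℝ] TangentSpace J y) (ψ : M → N) : Prop :=
  ∀ x : M, ∀ v ∈ tangentImage J I ψ x, φ (ψ x) v ∈ tangentImage J I ψ x

/-- The submanifold is slant with slant angle `θ`: for each tangent vector `v` not proportional to
`ξ`, the angle between `φ v` and the tangent space, i.e. between `φ v` and its orthogonal projection
to the tangent space (`π / 2` if this projection vanishes), is `θ`. -/
def IsSlant (φ : ∀ y : N, TangentSpace J y →L[ℝ] TangentSpace J y)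
    (ξ : ∀ y : N, TangentSpace J y) (θ : ℝ) (ψ : M → N) : Prop :=
  ∀ x : M, ∀ v ∈ tangentImage J I ψ x, v ∉ Submodule.span ℝ {ξ (ψ x)} →
    InnerProductGeometry.angle (φ (ψ x) v)
      ((tangentImage J I ψ x).starProjection (φ (ψ x) v)) = θ

/-- The structure vector field `ξ` is tangent to the submanifold. -/
def IsTangentTo (ξ : ∀ y : N, TangentSpace J y) (ψ : M → N) : Prop :=
  ∀ x : M, ξ (ψ x) ∈ tangentImage J I ψ x

variable [IsManifold I ∞ M]

/-- The second fundamental form `h(u, v) = (∇_U V)^⊥` of the submanifold `ψ : M → N`: the normal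
part of the ambient covariant derivative, in the direction of `u`, of a tangent vector field `V`
with value `v` at `x`. -/
def secondFundamentalForm (ψ : M → N) (x : M) (u v : TangentSpace I x) : TangentSpace J (ψ x) :=
  (tangentImage J I ψ x)ᗮ.starProjection
    (covariantDerivAlong J I ψ
      (fun z : M => mfderiv I J ψ z (FiberBundle.extend E v z : TangentSpace I z)) x u)

/-- `‖h‖² = ∑ᵢⱼ g(h(eᵢ, eⱼ), h(eᵢ, eⱼ))` for an orthonormal frame `(eᵢ)`. -/
def secondFundamentalFormNormSq (ψ : M → N) (x : M) : ℝ :=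
  ∑ i, ∑ j, (inner ℝ
    (secondFundamentalForm J I ψ x (orthonormalFrame J I ψ x i) (orthonormalFrame J I ψ x j))
    (secondFundamentalForm J I ψ x (orthonormalFrame J I ψ x i) (orthonormalFrame J I ψ x j)) : ℝ)

/-- The mean curvature vector `(1/n) ∑ᵢ h(eᵢ, eᵢ)` for an orthonormal frame `(eᵢ)`. -/
def meanCurvature (ψ : M → N) (x : M) : TangentSpace J (ψ x) :=
  ((Module.finrank ℝ (tangentImage J I ψ x) : ℝ)⁻¹) •
    ∑ i, secondFundamentalForm J I ψ x (orthonormalFrame J I ψ x i) (orthonormalFrame J I ψ x i)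

/-- The second fundamental form vanishes. -/
def IsTotallyGeodesic (ψ : M → N) : Prop :=
  ∀ (x : M) (u v : TangentSpace I x), secondFundamentalForm J I ψ x u v = 0

/-- `h(u, v) = g(u, v) H`, where `H` is the mean curvature vector. -/
def IsTotallyUmbilical (ψ : M → N) : Prop :=
  ∀ (x : M) (u v : TangentSpace I x),
    secondFundamentalForm J I ψ x u v = inducedMetric J I ψ x u v • meanCurvature J I ψ x

/-- The mean curvature vector vanishes. -/
def IsMinimal (ψ : M → N) : Prop :=
  ∀ x : M, meanCurvature J I ψ x = 0

end Submanifold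

/-! ### Warped products -/

section Warped

variable {E₁ : Type*} [NormedAddCommGroup E₁] [NormedSpace ℝ E₁] [FiniteDimensional ℝ E₁]
  {H₁ : Type*} [TopologicalSpace H₁] (I₁ : ModelWithCorners ℝ E₁ H₁)
  {M₁ : Type*} [TopologicalSpace M₁] [ChartedSpace H₁ M₁]
  [RiemannianBundle (fun p : M₁ => TangentSpace I₁ p)]
  {E₂ : Type*} [NormedAddCommGroup E₂] [NormedSpace ℝ E₂]
  {H₂ : Type*} [TopologicalSpace H₂] (I₂ : ModelWithCorners ℝ E₂ H₂)
  {M₂ : Type*} [TopologicalSpace M₂] [ChartedSpace H₂ M₂]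
  [RiemannianBundle (fun q : M₂ => TangentSpace I₂ q)]

/-- The gradient of a function on a Riemannian manifold: `⟨grad k, X⟩ = X k`. -/
def gradient (k : M₁ → ℝ) (p : M₁) : TangentSpace I₁ p :=
  haveI : CompleteSpace (TangentSpace I₁ p) := FiniteDimensional.complete ℝ _
  (InnerProductSpace.toDual ℝ (TangentSpace I₁ p)).symm (mvfderiv I₁ k p)

/-- The warped product metric `g₁ + f² g₂` of `M₁ ×_f M₂`, at the point `x`. -/
def warpedMetric (f : M₁ → ℝ) (x : M₁ × M₂) (u v : TangentSpace (I₁.prod I₂) x) : ℝ :=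
  inner ℝ (mfderiv (I₁.prod I₂) I₁ Prod.fst x u) (mfderiv (I₁.prod I₂) I₁ Prod.fst x v)
    + f x.1 ^ 2 *
      inner ℝ (mfderiv (I₁.prod I₂) I₂ Prod.snd x u) (mfderiv (I₁.prod I₂) I₂ Prod.snd x v)

variable {F : Type*} [NormedAddCommGroup F] [NormedSpace ℝ F] [FiniteDimensional ℝ F]
  {H : Type*} [TopologicalSpace H] (J : ModelWithCorners ℝ F H)
  {N : Type*} [TopologicalSpace N] [ChartedSpace H N] [IsManifold J ∞ N]
  [RiemannianBundle (fun y : N => TangentSpace J y)]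

/-- The map `ψ : M₁ × M₂ → N` exhibits the warped product `M₁ ×_f M₂` as a warped product
submanifold of `N`: `f` is positive and smooth, and `ψ` is a smooth isometric immersion of
`M₁ ×_f M₂` into `N`. -/
structure IsWarpedProductSubmanifold (f : M₁ → ℝ) (ψ : M₁ × M₂ → N) : Prop where
  smooth_f : ContMDiff I₁ 𝓘(ℝ, ℝ) ∞ f
  pos_f : ∀ p : M₁, 0 < f p
  smooth : ContMDiff (I₁.prod I₂) J ∞ ψ
  isometric : ∀ (x : M₁ × M₂) (u v : TangentSpace (I₁.prod I₂) x),
    inducedMetric J (I₁.prod I₂) ψ x u v = warpedMetric I₁ I₂ f x u v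

/-- `ψ : M₁ × M₂ → N` is a proper warped product semi-slant submanifold `M_T ×_f M_θ` with `ξ`
tangent to `M_T`, where `M_T = M₁` and `M_θ = M₂`: the submanifolds `M₁ × {q}` are invariant and
tangent to `ξ`, and the submanifolds `{p} × M₂` are slant with slant angle `θ ∈ (0, π/2)`.
(As `ξ` does not vanish, the dimension of `M₁` is automatically nonzero.) -/
structure IsProperWarpedProductSemiSlant
    (φ : ∀ y : N, TangentSpace J y →L[ℝ] TangentSpace J y) (ξ : ∀ y : N, TangentSpace J y)
    (θ : ℝ) (f : M₁ → ℝ) (ψ : M₁ × M₂ → N) : Prop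
    extends IsWarpedProductSubmanifold I₁ I₂ J f ψ where
  xi_tangent : ∀ q : M₂, IsTangentTo J I₁ ξ (fun p : M₁ => ψ (p, q))
  invariant : ∀ q : M₂, IsInvariant J I₁ φ (fun p : M₁ => ψ (p, q))
  slant : ∀ p : M₁, IsSlant J I₂ φ ξ θ (fun q : M₂ => ψ (p, q))
  theta_pos : 0 < θ
  theta_lt : θ < Real.pi / 2

end Warped

end KenmotsuGeometry

end

/-! Write T for vectors X tangent to M_T and Θ for vectors Z, W tangent to M_θ, let FW be the part
of φW orthogonal to M_θ, and put μ(X) = X(ln f) − η(X), ν(X) = (φX)(ln f). Everything rests on one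
formula for the mixed part of h: g(h(X,Z), FW) = μ(X) g(φZ,W) − ν(X) g(Z,W)
(`inner_hessian_normalPart`). It has two sources. The Koszul formula for g_T + f² g_θ gives the
required tangential components of ∇_X Y, ∇_X Z and ∇_Z W in terms of ∇ ln f; and differentiating
g(φX, Z) = 0 along M, with the Kenmotsu formula for ∇φ, moves φ from one argument to the other.

Since M_T is invariant, FW is normal to M, and the slant condition gives g(FZ,FW) = sin²θ g(Z,W). So
for an orthonormal frame (e_k) of M_θ the vectors csc θ · F e_k are orthonormal normals, and
Bessel's inequality yields ‖h(X,e_k)‖² ≥ csc²θ (cos²θ μ(X)² + ν(X)²); the cross term vanishes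
because g(φe_k,e_k) = 0 (`le_norm_sq_mixed`). Differentiating g(ξ,Z) = 0 gives ξ(ln f) = 1, whence,
over an orthonormal basis of T, both Σμ² = ‖∇ ln f − ξ‖² and Σν² = ‖φ∇ ln f‖² equal ‖∇ ln f‖² − 1.
There are 2s vectors e_k, the mixed block occurs twice in ‖h‖², and the pure blocks are nonnegative:
this is (i).

Equality forces h to vanish on T × T and on Θ × Θ. The trace of h is then zero, so M is minimal.
Moreover ∇_X Y is tangent to M and has no M_θ component, so M_T is totally geodesic; and ∇_Z W is
tangent to M with M_T component −g(Z,W) ∇ ln f, so M_θ is umbilical.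

The geometry enters through the second order data at one point, collected in `IsSemiSlantHessian`:
chart computations establish these relations, and the estimates afterwards are linear algebra. -/

set_option linter.unusedSectionVars false

noncomputable section

namespace KenmotsuGeometry

open Filter Topology
open scoped InnerProductSpace

/-! ### Derivatives along coordinate lines -/

section CoordinateLine

variable {E : Type*} [NormedAddCommGroup E] [NormedSpace ℝ E]
  {H' : Type*} [TopologicalSpace H'] (I : ModelWithCorners ℝ E H')
  {M : Type*} [TopologicalSpace M] [ChartedSpace H' M]

/-- The curve through `x` which in the preferred chart at `x` is the line with velocity `u`. -/
def coordinateLine (x : M) (u : E) (t : ℝ) : M :=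
  (extChartAt I x).symm (extChartAt I x x + t • u)

@[simp]
theorem coordinateLine_zero (x : M) (u : E) : coordinateLine I x u 0 = x := by
  simp [coordinateLine]

theorem continuousAt_coordinateLine (x : M) (u : E) :
    ContinuousAt (coordinateLine I x u) 0 := by
  refine ContinuousAt.comp (g := (extChartAt I x).symm)
    (f := fun t : ℝ => extChartAt I x x + t • u) ?_ (by fun_prop)
  simpa using continuousAt_extChartAt_symm (I := I) x

theorem tendsto_coordinateLine (x : M) (u : E) :
    Tendsto (coordinateLine I x u) (𝓝 0) (𝓝 x) := by
  simpa using (continuousAt_coordinateLine I x u).tendsto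

variable [I.Boundaryless]

variable {G : Type*} [NormedAddCommGroup G] [NormedSpace ℝ G]

/-- Along a coordinate line the manifold derivative becomes an ordinary one, so the product rules
below can be inherited from one-variable calculus. -/
theorem hasDerivAt_comp_coordinateLine {f : M → G} {x : M}
    (hf : MDifferentiableAt I 𝓘(ℝ, G) f x) (u : TangentSpace I x) :
    HasDerivAt (fun t => f (coordinateLine I x u t)) (mvfderiv I f x u) 0 := by
  obtain ⟨L, hL⟩ : ∃ L : E →L[ℝ] G, L = mvfderiv I f x := ⟨_, rfl⟩
  have h : HasFDerivWithinAt (fun a : E => f ((extChartAt I x).symm a)) L (Set.range I)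
      (extChartAt I x x) := hL ▸ hf.hasMFDerivAt.2
  -- Without boundary, the derivative within the range of the model is a genuine derivative.
  rw [I.range_eq_univ, hasFDerivWithinAt_univ] at h
  obtain ⟨u', hu⟩ : ∃ u' : E, u' = u := ⟨_, rfl⟩
  have hl : HasDerivAt (fun t : ℝ => extChartAt I x x + t • u') u' 0 := by
    simpa using ((hasDerivAt_id (0 : ℝ)).smul_const u').const_add (extChartAt I x x)
  rw [show extChartAt I x x = extChartAt I x x + (0 : ℝ) • u' by simp] at h
  rw [← hL, ← hu]
  exact h.comp_hasDerivAt (0 : ℝ) hl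

theorem mvfderiv_clm_apply {G' : Type*} [NormedAddCommGroup G'] [NormedSpace ℝ G']
    {A : M → G →L[ℝ] G'} {f : M → G} {x : M} (hA : MDifferentiableAt I 𝓘(ℝ, G →L[ℝ] G') A x)
    (hf : MDifferentiableAt I 𝓘(ℝ, G) f x) (u : TangentSpace I x) :
    mvfderiv I (fun z => A z (f z)) x u = mvfderiv I A x u (f x) + A x (mvfderiv I f x u) := by
  have h := (hasDerivAt_comp_coordinateLine I hA u).clm_apply
    (hasDerivAt_comp_coordinateLine I hf u)
  have h0 : coordinateLine I x (show E from u) 0 = x := coordinateLine_zero I x u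
  refine ((hasDerivAt_comp_coordinateLine I (hA.clm_apply hf) u).unique h).trans ?_
  exact congrArg (fun y => mvfderiv I A x u (f y) + A y (mvfderiv I f x u)) h0

omit [I.Boundaryless] in
theorem mvfderiv_comp_apply_along {F : Type*} [NormedAddCommGroup F] [NormedSpace ℝ F]
    {H : Type*} [TopologicalSpace H] (J : ModelWithCorners ℝ F H)
    {N : Type*} [TopologicalSpace N] [ChartedSpace H N] {f : N → G} {ψ : M → N} {x : M}
    (hf : MDifferentiableAt J 𝓘(ℝ, G) f (ψ x)) (hψ : MDifferentiableAt I J ψ x)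
    (u : TangentSpace I x) :
    mvfderiv I (fun z => f (ψ z)) x u = mvfderiv J f (ψ x) (mfderiv I J ψ x u) :=
  congrArg (fun L => L u) (mfderiv_comp x hf hψ)

omit [I.Boundaryless] in
theorem mvfderiv_congr {f g : M → G} {x : M} (h : f =ᶠ[𝓝 x] g) (u : TangentSpace I x) :
    mvfderiv I f x u = mvfderiv I g x u := by
  have := h.mfderiv_eq (I := I) (I' := 𝓘(ℝ, G))
  exact congrArg (fun L : E →L[ℝ] G => L u) this

end CoordinateLine

/-! ### The preferred trivialization of the tangent bundle -/

section Trivialization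

variable {F : Type*} [NormedAddCommGroup F] [NormedSpace ℝ F]
  {H : Type*} [TopologicalSpace H] (J : ModelWithCorners ℝ F H)
  {N : Type*} [TopologicalSpace N] [ChartedSpace H N] [IsManifold J ∞ N]

theorem trivializationAt_self_snd (y : N) (v : TangentSpace J y) :
    (trivializationAt F (fun y : N => TangentSpace J y) y ⟨y, v⟩).2 = (show F from v) :=
  (tangentBundleCore J N).coordChange_self (achart H y) y (mem_achart_source H y) v

theorem trivializationAt_self_symm (y : N) (v : TangentSpace J y) :
    (trivializationAt F (fun y : N => TangentSpace J y) y).symm y (show F from v) = v := by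
  have := (trivializationAt F (fun y : N => TangentSpace J y) y).symm_apply_apply_mk
    (mem_baseSet_trivializationAt F _ y) v
  rwa [trivializationAt_self_snd] at this

theorem trivialization_mem_nhds (y : N) :
    ∀ᶠ z in 𝓝 y, z ∈ (trivializationAt F (fun y : N => TangentSpace J y) y).baseSet :=
  (trivializationAt F (fun y : N => TangentSpace J y) y).open_baseSet.mem_nhds
    (mem_baseSet_trivializationAt F _ y)

theorem contMDiffAt_extend (y : N) (v : TangentSpace J y) :
    ContMDiffAt J (J.prod 𝓘(ℝ, F)) ∞
      (fun z : N => (TotalSpace.mk' F z (FiberBundle.extend F v z : TangentSpace J z) :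
        TotalSpace F (fun z : N => TangentSpace J z))) y := by
  rw [contMDiffAt_section]
  refine (contMDiffAt_const (c := (show F from v))).congr_of_eventuallyEq ?_
  filter_upwards [trivialization_mem_nhds J y] with z hz
  simp only [FiberBundle.extend]
  rw [Trivialization.apply_mk_symm _ hz]
  exact trivializationAt_self_snd J y v

end Trivialization

/-! ### The Christoffel symbol of the first kind -/

section KoszulForm

variable {F : Type*} [NormedAddCommGroup F] [NormedSpace ℝ F]

/-- The Christoffel symbol of the first kind of a metric with derivative `T`. -/
def koszulForm (T : F →L[ℝ] F →L[ℝ] F →L[ℝ] ℝ) (u v w : F) : ℝ :=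
  (1 / 2) * (T u v w + T v u w - T w u v)

theorem koszulForm_add_left (T : F →L[ℝ] F →L[ℝ] F →L[ℝ] ℝ) (u u' v w : F) :
    koszulForm T (u + u') v w = koszulForm T u v w + koszulForm T u' v w := by
  change (1 / 2) * (T (u + u') v w + T v (u + u') w - T w (u + u') v) = _
  rw [T.map_add, (T v).map_add, (T w).map_add]
  change (1 / 2) * (T u v w + T u' v w + (T v u w + T v u' w) - (T w u v + T w u' v)) = _
  rw [koszulForm, koszulForm]
  ring

theorem koszulForm_smul_left (T : F →L[ℝ] F →L[ℝ] F →L[ℝ] ℝ) (c : ℝ) (u v w : F) :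
    koszulForm T (c • u) v w = c * koszulForm T u v w := by
  change (1 / 2) * (T (c • u) v w + T v (c • u) w - T w (c • u) v) = _
  rw [T.map_smul, (T v).map_smul, (T w).map_smul]
  change (1 / 2) * (c * T u v w + c * T v u w - c * T w u v) = _
  rw [koszulForm]
  ring

theorem koszulForm_add_right (T : F →L[ℝ] F →L[ℝ] F →L[ℝ] ℝ) (u v w w' : F) :
    koszulForm T u v (w + w') = koszulForm T u v w + koszulForm T u v w' := by
  change (1 / 2) * (T u v (w + w') + T v u (w + w') - T (w + w') u v) = _
  rw [T.map_add, (T u v).map_add, (T v u).map_add]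
  change (1 / 2) * (T u v w + T u v w' + (T v u w + T v u w') - (T w u v + T w' u v)) = _
  rw [koszulForm, koszulForm]
  ring

theorem koszulForm_smul_right (T : F →L[ℝ] F →L[ℝ] F →L[ℝ] ℝ) (c : ℝ) (u v w : F) :
    koszulForm T u v (c • w) = c * koszulForm T u v w := by
  change (1 / 2) * (T u v (c • w) + T v u (c • w) - T (c • w) u v) = _
  rw [T.map_smul, (T u v).map_smul, (T v u).map_smul]
  change (1 / 2) * (c * T u v w + c * T v u w - c * T w u v) = _
  rw [koszulForm]
  ring

/-- The algebra behind torsion-freeness. -/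
theorem koszulForm_comm {T : F →L[ℝ] F →L[ℝ] F →L[ℝ] ℝ} (hT : ∀ a b c, T a b c = T a c b)
    (u v w : F) : koszulForm T u v w = koszulForm T v u w := by
  rw [koszulForm, koszulForm, hT w u v, add_comm (T u v w)]

/-- The algebra behind metric compatibility: two Christoffel symbols add up to ∂_u g(v, w). -/
theorem koszulForm_add_koszulForm {T : F →L[ℝ] F →L[ℝ] F →L[ℝ] ℝ}
    (hT : ∀ a b c, T a b c = T a c b) (u v w : F) :
    koszulForm T u v w + koszulForm T u w v = T u v w := by
  rw [koszulForm, koszulForm, hT w u v, hT u w v, hT v u w]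
  ring

end KoszulForm

/-! ### Covariant derivatives along maps -/

section Covariant

variable {F : Type*} [NormedAddCommGroup F] [NormedSpace ℝ F]
  {H : Type*} [TopologicalSpace H] (J : ModelWithCorners ℝ F H)
  {N : Type*} [TopologicalSpace N] [ChartedSpace H N] [IsManifold J ∞ N]
  [RiemannianBundle (fun y : N => TangentSpace J y)]
  [IsContMDiffRiemannianBundle J ∞ F (fun y : N => TangentSpace J y)]

/-- The metric near `y₀`, read in the preferred chart at `y₀`. -/
theorem exists_metric_inCoordinates (y₀ : N) : ∃ G : N → F →L[ℝ] F →L[ℝ] ℝ,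
    MDifferentiableAt J 𝓘(ℝ, F →L[ℝ] F →L[ℝ] ℝ) G y₀ ∧
    ∀ᶠ z in 𝓝 y₀, ∀ v w : TangentSpace J z, (inner ℝ v w : ℝ) =
      G z (trivializationAt F (fun y : N => TangentSpace J y) y₀ ⟨z, v⟩).2
        (trivializationAt F (fun y : N => TangentSpace J y) y₀ ⟨z, w⟩).2 := by
  obtain ⟨g, hg, hin⟩ := ‹IsContMDiffRiemannianBundle J ∞ F
    (fun y : N => TangentSpace J y)›.exists_contMDiff
  refine ⟨_, ((contMDiffAt_hom_bundle _).1 (hg y₀)).2.mdifferentiableAt (by simp), ?_⟩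
  filter_upwards [trivialization_mem_nhds J y₀] with z hz v w
  have := inCoordinates_apply_eq₂ (x₀ := y₀) (x := z) (𝕜 := ℝ)
    (E₁ := fun y : N => TangentSpace J y) (E₂ := fun y : N => TangentSpace J y)
    (E₃ := Bundle.Trivial N ℝ) (F₁ := F) (F₂ := F) (F₃ := ℝ)
    (ϕ := g z) (v := (trivializationAt F (fun y : N => TangentSpace J y) y₀ ⟨z, v⟩).2)
    (w := (trivializationAt F (fun y : N => TangentSpace J y) y₀ ⟨z, w⟩).2) hz hz
    (Set.mem_univ z)
  rw [Trivialization.symm_apply_apply_mk _ hz, Trivialization.symm_apply_apply_mk _ hz] at this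
  rw [hin]
  refine Eq.trans ?_ this.symm
  simp

theorem mdifferentiableAt_inner_along {E : Type*} [NormedAddCommGroup E] [NormedSpace ℝ E]
    {H' : Type*} [TopologicalSpace H'] {I : ModelWithCorners ℝ E H'}
    {M : Type*} [TopologicalSpace M] [ChartedSpace H' M] {ψ : M → N}
    {σ τ : ∀ z : M, TangentSpace J (ψ z)} {x : M}
    (hσ : MDifferentiableAt I (J.prod 𝓘(ℝ, F)) (fun z => (TotalSpace.mk' F (ψ z) (σ z) :
      TotalSpace F (fun y : N => TangentSpace J y))) x)
    (hτ : MDifferentiableAt I (J.prod 𝓘(ℝ, F)) (fun z => (TotalSpace.mk' F (ψ z) (τ z) :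
      TotalSpace F (fun y : N => TangentSpace J y))) x) :
    MDifferentiableAt I 𝓘(ℝ, ℝ) (fun z => (inner ℝ (σ z) (τ z) : ℝ)) x :=
  MDifferentiableAt.inner_bundle (IB := J) (F := F) (E := fun y : N => TangentSpace J y)
    (b := ψ) (v := σ) (w := τ) hσ hτ

variable [J.Boundaryless]

/-- Coordinate fields have constant components near `y₀`, so only the metric coefficients are
differentiated. -/
theorem mvfderiv_inner_extend {y₀ : N} {G : N → F →L[ℝ] F →L[ℝ] ℝ}
    (hG : MDifferentiableAt J 𝓘(ℝ, F →L[ℝ] F →L[ℝ] ℝ) G y₀)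
    (hin : ∀ᶠ z in 𝓝 y₀, ∀ v w : TangentSpace J z, (inner ℝ v w : ℝ) =
      G z (trivializationAt F (fun y : N => TangentSpace J y) y₀ ⟨z, v⟩).2
        (trivializationAt F (fun y : N => TangentSpace J y) y₀ ⟨z, w⟩).2)
    {dG : F →L[ℝ] F →L[ℝ] F →L[ℝ] ℝ} (hdG : dG = mvfderiv J G y₀) (a b c : TangentSpace J y₀) :
    mvfderiv J (fun z : N => inner ℝ (FiberBundle.extend F b z : TangentSpace J z)
        (FiberBundle.extend F c z : TangentSpace J z)) y₀ a = dG a b c := by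
  have hd := mdifferentiableAt_inner_along J (ψ := fun z : N => z)
    ((contMDiffAt_extend J y₀ b).mdifferentiableAt (by simp))
    ((contMDiffAt_extend J y₀ c).mdifferentiableAt (by simp))
  have h₁ := hasDerivAt_comp_coordinateLine J hd a
  obtain ⟨b', hb⟩ : ∃ b' : F, b' = b := ⟨_, rfl⟩
  obtain ⟨c', hc⟩ : ∃ c' : F, c' = c := ⟨_, rfl⟩
  have h₀ : HasDerivAt (fun t => G (coordinateLine J y₀ a t)) (dG a) 0 :=
    hdG ▸ hasDerivAt_comp_coordinateLine J hG a
  have h₂ := (h₀.clm_apply (hasDerivAt_const 0 b')).clm_apply (hasDerivAt_const 0 c')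
  have h₃ := h₂.congr_of_eventuallyEq (f₁ := fun t =>
    inner ℝ (FiberBundle.extend F b (coordinateLine J y₀ a t) : TangentSpace J _)
      (FiberBundle.extend F c (coordinateLine J y₀ a t) : TangentSpace J _)) (by
    filter_upwards [(tendsto_coordinateLine J y₀ a).eventually hin,
      (tendsto_coordinateLine J y₀ a).eventually (trivialization_mem_nhds J y₀)] with t ht hz
    rw [ht]
    simp only [FiberBundle.extend]
    rw [Trivialization.apply_mk_symm _ hz, Trivialization.apply_mk_symm _ hz,
      trivializationAt_self_snd, trivializationAt_self_snd, hb, hc])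
  refine (h₁.unique h₃).trans ?_
  simp [hb, hc]

/-- Exhibits `koszul` as built from a trilinear map; its linearity in each argument is not visible
in the definition through extended fields. -/
theorem exists_koszul_eq (y₀ : N) : ∃ (G : N → F →L[ℝ] F →L[ℝ] ℝ)
    (dG : F →L[ℝ] F →L[ℝ] F →L[ℝ] ℝ),
    MDifferentiableAt J 𝓘(ℝ, F →L[ℝ] F →L[ℝ] ℝ) G y₀ ∧
    dG = mvfderiv J G y₀ ∧
    (∀ᶠ z in 𝓝 y₀, ∀ v w : TangentSpace J z, (inner ℝ v w : ℝ) =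
      G z (trivializationAt F (fun y : N => TangentSpace J y) y₀ ⟨z, v⟩).2
        (trivializationAt F (fun y : N => TangentSpace J y) y₀ ⟨z, w⟩).2) ∧
    (∀ a b c : F, dG a b c = dG a c b) ∧
    ∀ u v w : TangentSpace J y₀,
      koszul J y₀ u v w = koszulForm dG u v w := by
  obtain ⟨G, hG, hin⟩ := exists_metric_inCoordinates J y₀
  refine ⟨G, mvfderiv J G y₀, hG, rfl, hin, fun a b c => ?_, fun u v w => ?_⟩
  · have hs := fun b c => mvfderiv_inner_extend J hG hin rfl (show TangentSpace J y₀ from a) b c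
    refine (hs b c).symm.trans (Eq.trans ?_ (hs c b))
    simp only [real_inner_comm]
  · rw [koszul, mvfderiv_inner_extend J hG hin rfl, mvfderiv_inner_extend J hG hin rfl,
      mvfderiv_inner_extend J hG hin rfl]
    rfl

variable [FiniteDimensional ℝ F]

/-- Linearity of `koszul` in the last slot, read off in coordinates, is what allows `w` to be
expanded in the orthonormal basis. -/
theorem inner_christoffel (y : N) (u v w : TangentSpace J y) :
    (inner ℝ (christoffel J y u v) w : ℝ) = koszul J y u v w := by
  obtain ⟨G, dG, -, -, -, -, hk⟩ := exists_koszul_eq J y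
  let L : TangentSpace J y →ₗ[ℝ] ℝ :=
    { toFun := fun w => koszul J y u v w
      map_add' := fun a b => by
        rw [hk, hk, hk]
        exact koszulForm_add_right dG u v a b
      map_smul' := fun c a => by
        rw [hk, hk]
        exact koszulForm_smul_right dG c u v a }
  have hL : ∀ a, koszul J y u v a = L a := fun _ => rfl
  rw [christoffel, sum_inner, hL w]
  conv_rhs => rw [← (stdOrthonormalBasis ℝ (TangentSpace J y)).sum_repr w, map_sum]
  refine Finset.sum_congr rfl fun i _ => ?_
  rw [map_smul, real_inner_smul_left, hL, smul_eq_mul, mul_comm,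
    OrthonormalBasis.repr_apply_apply]

theorem christoffel_comm (y : N) (u v : TangentSpace J y) :
    christoffel J y u v = christoffel J y v u := by
  obtain ⟨G, dG, -, -, -, hs, hk⟩ := exists_koszul_eq J y
  refine ext_inner_right ℝ fun w => ?_
  rw [inner_christoffel, inner_christoffel, hk, hk]
  exact koszulForm_comm hs u v w

theorem christoffel_add_left (y : N) (u u' v : TangentSpace J y) :
    christoffel J y (u + u') v = christoffel J y u v + christoffel J y u' v := by
  obtain ⟨G, dG, -, -, -, -, hk⟩ := exists_koszul_eq J y
  refine ext_inner_right ℝ fun w => ?_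
  rw [inner_add_left, inner_christoffel, inner_christoffel, inner_christoffel, hk, hk, hk]
  exact koszulForm_add_left dG u u' v w

theorem christoffel_smul_left (y : N) (c : ℝ) (u v : TangentSpace J y) :
    christoffel J y (c • u) v = c • christoffel J y u v := by
  obtain ⟨G, dG, -, -, -, -, hk⟩ := exists_koszul_eq J y
  refine ext_inner_right ℝ fun w => ?_
  rw [real_inner_smul_left, inner_christoffel, inner_christoffel, hk, hk]
  exact koszulForm_smul_left dG c u v w

end Covariant

/-! ### Metric compatibility and the Kenmotsu identity for fields along a map -/

section CovariantAlong

variable {F : Type*} [NormedAddCommGroup F] [NormedSpace ℝ F] [FiniteDimensional ℝ F]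
  {H : Type*} [TopologicalSpace H] (J : ModelWithCorners ℝ F H) [J.Boundaryless]
  {N : Type*} [TopologicalSpace N] [ChartedSpace H N] [IsManifold J ∞ N]
  [RiemannianBundle (fun y : N => TangentSpace J y)]
  {E : Type*} [NormedAddCommGroup E] [NormedSpace ℝ E]
  {H' : Type*} [TopologicalSpace H'] (I : ModelWithCorners ℝ E H') [I.Boundaryless]
  {M : Type*} [TopologicalSpace M] [ChartedSpace H' M]

omit [FiniteDimensional ℝ F] [J.Boundaryless] [I.Boundaryless]
  [RiemannianBundle (fun y : N => TangentSpace J y)] in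
theorem mdifferentiableAt_along {ψ : M → N} {σ : ∀ z : M, TangentSpace J (ψ z)} {x : M} :
    MDifferentiableAt I (J.prod 𝓘(ℝ, F)) (fun z => (TotalSpace.mk' F (ψ z) (σ z) :
      TotalSpace F (fun y : N => TangentSpace J y))) x ↔
    MDifferentiableAt I J ψ x ∧ MDifferentiableAt I 𝓘(ℝ, F) (fun z =>
      (trivializationAt F (fun y : N => TangentSpace J y) (ψ x) ⟨ψ z, σ z⟩).2) x :=
  mdifferentiableAt_totalSpace (IB := J) _

omit [J.Boundaryless] [I.Boundaryless] in
theorem covariantDerivAlong_eq (ψ : M → N) (σ : ∀ z : M, TangentSpace J (ψ z)) (x : M)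
    (u : TangentSpace I x) :
    covariantDerivAlong J I ψ σ x u =
      (show TangentSpace J (ψ x) from mvfderiv I (fun z : M =>
        ((trivializationAt F (fun y : N => TangentSpace J y) (ψ x)) ⟨ψ z, σ z⟩).2) x u) +
      christoffel J (ψ x) (mfderiv I J ψ x u) (σ x) := by
  rw [covariantDerivAlong]
  congr 1
  exact trivializationAt_self_symm J (ψ x) _

variable [IsContMDiffRiemannianBundle J ∞ F (fun y : N => TangentSpace J y)]

/-- The Levi-Civita connection is compatible with the metric, along maps. -/
theorem mvfderiv_inner_along {ψ : M → N} {σ τ : ∀ z : M, TangentSpace J (ψ z)} {x : M}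
    (hσ : MDifferentiableAt I (J.prod 𝓘(ℝ, F)) (fun z => (TotalSpace.mk' F (ψ z) (σ z) :
      TotalSpace F (fun y : N => TangentSpace J y))) x)
    (hτ : MDifferentiableAt I (J.prod 𝓘(ℝ, F)) (fun z => (TotalSpace.mk' F (ψ z) (τ z) :
      TotalSpace F (fun y : N => TangentSpace J y))) x) (u : TangentSpace I x) :
    mvfderiv I (fun z => (inner ℝ (σ z) (τ z) : ℝ)) x u =
      inner ℝ (covariantDerivAlong J I ψ σ x u) (τ x) +
        inner ℝ (σ x) (covariantDerivAlong J I ψ τ x u) := by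
  obtain ⟨G, dG, hG, hdG, hin, hs, hk⟩ := exists_koszul_eq J (ψ x)
  obtain ⟨hψ, hσ'⟩ := (mdifferentiableAt_along J I).1 hσ
  obtain ⟨-, hτ'⟩ := (mdifferentiableAt_along J I).1 hτ
  have hGψ : MDifferentiableAt I 𝓘(ℝ, F →L[ℝ] F →L[ℝ] ℝ) (fun z => G (ψ z)) x := hG.comp x hψ
  obtain ⟨w, hw⟩ : ∃ w : F, w = mfderiv I J ψ x u := ⟨_, rfl⟩
  have hGw : mvfderiv I (fun z => G (ψ z)) x u = dG w := by
    rw [mvfderiv_comp_apply_along I J hG hψ, hw, hdG]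
    rfl
  have hev : (fun z => (inner ℝ (σ z) (τ z) : ℝ)) =ᶠ[𝓝 x] fun z => G (ψ z)
      (trivializationAt F (fun y : N => TangentSpace J y) (ψ x) ⟨ψ z, σ z⟩).2
      (trivializationAt F (fun y : N => TangentSpace J y) (ψ x) ⟨ψ z, τ z⟩).2 :=
    (hψ.continuousAt.eventually hin).mono fun z hz => hz (σ z) (τ z)
  rw [mvfderiv_congr I hev, mvfderiv_clm_apply I (hGψ.clm_apply hσ') hτ',
    mvfderiv_clm_apply I hGψ hσ', hGw]
  have hin₀ : ∀ v v' : TangentSpace J (ψ x), (inner ℝ v v' : ℝ) = G (ψ x) v v' := by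
    intro v v'
    rw [hin.self_of_nhds v v', trivializationAt_self_snd, trivializationAt_self_snd]
  have hΓ : ∀ v v' : TangentSpace J (ψ x),
      (inner ℝ (christoffel J (ψ x) (mfderiv I J ψ x u) v) v' : ℝ) = koszulForm dG w v v' := by
    intro v v'
    rw [inner_christoffel, hk, hw]
  rw [covariantDerivAlong_eq, covariantDerivAlong_eq, inner_add_left, inner_add_right, hΓ,
    ← real_inner_comm (σ x), ← real_inner_comm (σ x), hΓ, real_inner_comm, hin₀, hin₀,
    trivializationAt_self_snd, trivializationAt_self_snd]
  -- The two Christoffel terms account for the derivative of the metric coefficients; the remaining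
  -- terms are the product rule in `σ` and `τ`.
  have hsum := koszulForm_add_koszulForm hs w (σ x) (τ x)
  change dG w (σ x) (τ x) + G (ψ x) _ (τ x) + G (ψ x) (σ x) _ = _
  have hsym : ∀ v v' : F, G (ψ x) v v' = G (ψ x) v' v := fun v v' =>
    (hin₀ v v').symm.trans ((real_inner_comm (F := TangentSpace J (ψ x)) v' v).trans (hin₀ v' v))
  rw [← hsum]
  refine Eq.trans ?_ (congrArg₂ (fun b c : ℝ => b + koszulForm dG w (σ x) (τ x) +
    (c + koszulForm dG w (τ x) (σ x))) (hsym _ (τ x)) (hsym (σ x) _))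
  ring

omit [IsContMDiffRiemannianBundle J ∞ F (fun y : N => TangentSpace J y)] in
/-- The Kenmotsu condition `(∇_X φ) Y = g(φ X, Y) ξ - η(Y) φ X`, along maps. -/
theorem IsKenmotsu.nabla_phi_along {φ : ∀ y : N, TangentSpace J y →L[ℝ] TangentSpace J y}
    {ξ : ∀ y : N, TangentSpace J y} {η : ∀ y : N, TangentSpace J y →L[ℝ] ℝ}
    (hN : IsKenmotsu J φ ξ η) {ψ : M → N} {σ : ∀ z : M, TangentSpace J (ψ z)} {x : M}
    (hσ : MDifferentiableAt I (J.prod 𝓘(ℝ, F)) (fun z => (TotalSpace.mk' F (ψ z) (σ z) :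
      TotalSpace F (fun y : N => TangentSpace J y))) x) (u : TangentSpace I x) :
    MDifferentiableAt I (J.prod 𝓘(ℝ, F)) (fun z => (TotalSpace.mk' F (ψ z) (φ (ψ z) (σ z)) :
      TotalSpace F (fun y : N => TangentSpace J y))) x ∧
    covariantDerivAlong J I ψ (fun z => φ (ψ z) (σ z)) x u =
      φ (ψ x) (covariantDerivAlong J I ψ σ x u) +
        (inner ℝ (φ (ψ x) (mfderiv I J ψ x u)) (σ x) : ℝ) • ξ (ψ x) -
          η (ψ x) (σ x) • φ (ψ x) (mfderiv I J ψ x u) := by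
  have hΦ₀ := ((contMDiffAt_hom_bundle _).1 (hN.smooth_phi (ψ x))).2.mdifferentiableAt (by simp)
  obtain ⟨Φ, hΦ, hin⟩ : ∃ Φ : N → F →L[ℝ] F, MDifferentiableAt J 𝓘(ℝ, F →L[ℝ] F) Φ (ψ x) ∧
      ∀ᶠ z in 𝓝 (ψ x), ∀ v : TangentSpace J z,
        (trivializationAt F (fun y : N => TangentSpace J y) (ψ x) ⟨z, φ z v⟩).2 =
          Φ z (trivializationAt F (fun y : N => TangentSpace J y) (ψ x) ⟨z, v⟩).2 := by
    refine ⟨_, hΦ₀, ?_⟩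
    filter_upwards [trivialization_mem_nhds J (ψ x)] with z hz v
    refine Eq.symm ((congrArg (fun L : F →L[ℝ] F => L _) (ContinuousLinearMap.inCoordinates_eq
      (𝕜₁ := ℝ) (𝕜₂ := ℝ) (σ := RingHom.id ℝ) (F := F) (F' := F)
      (E := fun y : N => TangentSpace J y) (E' := fun y : N => TangentSpace J y)
      (ϕ := φ z) hz hz)).trans ?_)
    have hv := ((trivializationAt F (fun y : N => TangentSpace J y)
      (ψ x)).continuousLinearEquivAt ℝ z hz).symm_apply_apply v
    exact congrArg (fun a : TangentSpace J z =>
      (trivializationAt F (fun y : N => TangentSpace J y) (ψ x) ⟨z, φ z a⟩).2) hv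
  obtain ⟨hψ, hσ'⟩ := (mdifferentiableAt_along J I).1 hσ
  have hΦψ : MDifferentiableAt I 𝓘(ℝ, F →L[ℝ] F) (fun z => Φ (ψ z)) x := hΦ.comp x hψ
  have hev : (fun z => (trivializationAt F (fun y : N => TangentSpace J y) (ψ x)
      ⟨ψ z, φ (ψ z) (σ z)⟩).2) =ᶠ[𝓝 x] fun z => Φ (ψ z)
        (trivializationAt F (fun y : N => TangentSpace J y) (ψ x) ⟨ψ z, σ z⟩).2 :=
    (hψ.continuousAt.eventually hin).mono fun z hz => hz (σ z)
  refine ⟨(mdifferentiableAt_along J I).2 ⟨hψ, (hΦψ.clm_apply hσ').congr_of_eventuallyEq hev⟩, ?_⟩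
  have hΦ₀ : ∀ v : TangentSpace J (ψ x), Φ (ψ x) v = φ (ψ x) v := by
    intro v
    have := hin.self_of_nhds v
    rw [trivializationAt_self_snd, trivializationAt_self_snd] at this
    exact this.symm
  set w := mfderiv I J ψ x u with hw
  set a := σ x with ha
  -- The hypothesis concerns fields on `N`, so it is tested on the field with constant components
  -- `a`. This gives the derivative of the matrix `Φ` of `φ` up to Christoffel terms, and the
  -- product rule then handles any `σ`.
  have hext := contMDiffAt_extend J (ψ x) a
  have hcoord : ∀ᶠ z in 𝓝 (ψ x), (trivializationAt F (fun y : N => TangentSpace J y) (ψ x)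
      ⟨z, FiberBundle.extend F a z⟩).2 = (show F from a) := by
    filter_upwards [trivialization_mem_nhds J (ψ x)] with z hz
    simp only [FiberBundle.extend]
    rw [Trivialization.apply_mk_symm _ hz]
    exact trivializationAt_self_snd J (ψ x) a
  have hL₁ : leviCivita J (fun z => FiberBundle.extend F a z) (ψ x) w =
      christoffel J (ψ x) w a := by
    rw [leviCivita, covariantDerivAlong_eq, mvfderiv_congr J hcoord, mvfderiv_const,
      show mfderiv J J (fun z : N => z) (ψ x) = ContinuousLinearMap.id ℝ _ from mfderiv_id,
      FiberBundle.extend_apply_self]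
    exact zero_add _
  have hev' : (fun z => (trivializationAt F (fun y : N => TangentSpace J y) (ψ x)
      ⟨z, φ z (FiberBundle.extend F a z)⟩).2) =ᶠ[𝓝 (ψ x)] fun z => Φ z (show F from a) := by
    filter_upwards [hin, hcoord] with z h₁ h₂
    rw [h₁, h₂]
  have hL₂ : leviCivita J (fun z => φ z (FiberBundle.extend F a z)) (ψ x) w =
      (show TangentSpace J (ψ x) from mvfderiv J Φ (ψ x) w (show F from a)) +
        christoffel J (ψ x) w (φ (ψ x) a) := by
    rw [leviCivita, covariantDerivAlong_eq, mvfderiv_congr J hev',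
      mvfderiv_clm_apply J hΦ mdifferentiableAt_const, mvfderiv_const,
      show mfderiv J J (fun z : N => z) (ψ x) = ContinuousLinearMap.id ℝ _ from mfderiv_id,
      FiberBundle.extend_apply_self]
    congr 1
    refine (congrArg _ (Φ (ψ x)).map_zero).trans (add_zero _)
  have hK := hN.nabla_phi (ψ x) w (fun z => FiberBundle.extend F a z) hext
  rw [hL₁, hL₂, FiberBundle.extend_apply_self] at hK
  rw [covariantDerivAlong_eq, covariantDerivAlong_eq, mvfderiv_congr I hev,
    mvfderiv_clm_apply I hΦψ hσ', mvfderiv_comp_apply_along I J hΦ hψ, trivializationAt_self_snd,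
    map_add, add_sub_assoc, ← hK]
  have h₄ := hΦ₀ (mvfderiv I (fun z =>
    (trivializationAt F (fun y : N => TangentSpace J y) (ψ x) ⟨ψ z, σ z⟩).2) x u)
  refine (congrArg (fun b : F => (show TangentSpace J (ψ x) from
    mvfderiv J Φ (ψ x) w (show F from a)) + (show TangentSpace J (ψ x) from b) +
      christoffel J (ψ x) w (φ (ψ x) a)) h₄).trans ?_
  abel

end CovariantAlong

theorem two_le_infty : (2 : WithTop ℕ∞) ≤ ∞ :=
  WithTop.coe_le_coe.2 (le_top : (2 : ℕ∞) ≤ ⊤)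

theorem one_add_one_le_infty : (1 : WithTop ℕ∞) + 1 ≤ ∞ := by
  rw [one_add_one_eq_two]
  exact two_le_infty

/-! ### The Hessian of a map -/

section Hessian

variable {F : Type*} [NormedAddCommGroup F] [NormedSpace ℝ F] [FiniteDimensional ℝ F]
  {H : Type*} [TopologicalSpace H] (J : ModelWithCorners ℝ F H) [J.Boundaryless]
  {N : Type*} [TopologicalSpace N] [ChartedSpace H N] [IsManifold J ∞ N]
  [RiemannianBundle (fun y : N => TangentSpace J y)]
  {E : Type*} [NormedAddCommGroup E] [NormedSpace ℝ E]
  {H' : Type*} [TopologicalSpace H'] (I : ModelWithCorners ℝ E H') [I.Boundaryless]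
  {M : Type*} [TopologicalSpace M] [ChartedSpace H' M] [IsManifold I ∞ M]

/-- The covariant derivative `∇_u dψ(V)`, where `V` is the coordinate vector field with value `v`
at `x`. -/
def mapHessian (ψ : M → N) (x : M) (u v : TangentSpace I x) : TangentSpace J (ψ x) :=
  covariantDerivAlong J I ψ
    (fun z : M => mfderiv I J ψ z (FiberBundle.extend E v z : TangentSpace I z)) x u

omit [FiniteDimensional ℝ F] [J.Boundaryless] [IsManifold J ∞ N] [IsManifold I ∞ M]
  [RiemannianBundle (fun y : N => TangentSpace J y)] in
theorem contDiffAt_writtenInExtChartAt {ψ : M → N} (hψ : ContMDiff I J ∞ ψ) (x : M) :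
    ContDiffAt ℝ ∞ (writtenInExtChartAt I J x ψ) (extChartAt I x x) := by
  have := (contMDiffAt_iff.1 (hψ x)).2
  rwa [I.range_eq_univ, contDiffWithinAt_univ] at this

-- Differentiate "chart after ψ equals chart expression after chart" at nearby points: the
-- differentials of the charts are the preferred trivializations, in which the coordinate field is
-- constant.
omit [FiniteDimensional ℝ F] [J.Boundaryless]
  [RiemannianBundle (fun y : N => TangentSpace J y)] in
theorem trivialization_mfderiv_extend {ψ : M → N}
    (hψ : ContMDiff I J ∞ ψ) (x : M) (v : TangentSpace I x) :
    ∀ᶠ z in 𝓝 x, (trivializationAt F (fun y : N => TangentSpace J y) (ψ x)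
      ⟨ψ z, mfderiv I J ψ z (FiberBundle.extend E v z : TangentSpace I z)⟩).2 =
        fderiv ℝ (writtenInExtChartAt I J x ψ) (extChartAt I x z) (show E from v) := by
  have hd : ∀ᶠ a in 𝓝 (extChartAt I x x), DifferentiableAt ℝ (writtenInExtChartAt I J x ψ) a := by
    filter_upwards [((contDiffAt_writtenInExtChartAt J I hψ x).of_le
      (show (1 : WithTop ℕ∞) ≤ ∞ by simp)).eventually (by simp)] with a ha
    exact ha.differentiableAt (by simp)
  have hs : ∀ᶠ z in 𝓝 x, z ∈ (chartAt H' x).source :=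
    (chartAt H' x).open_source.mem_nhds (mem_chart_source H' x)
  have ht : ∀ᶠ z in 𝓝 x, ψ z ∈ (chartAt H (ψ x)).source :=
    hψ.continuous.continuousAt.eventually ((chartAt H (ψ x)).open_source.mem_nhds (mem_chart_source H (ψ x)))
  filter_upwards [(continuousAt_extChartAt (I := I) x).eventually hd, hs, ht,
    hs.eventually_nhds] with z hd hs ht hs'
  have hψ₂ : MDifferentiableAt I J ψ z := (hψ z).mdifferentiableAt (by simp)
  have he : MDifferentiableAt I 𝓘(ℝ, E) (extChartAt I x) z := mdifferentiableAt_extChartAt hs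
  have he' : MDifferentiableAt J 𝓘(ℝ, F) (extChartAt J (ψ x)) (ψ z) :=
    mdifferentiableAt_extChartAt ht
  have hev : (fun z => extChartAt J (ψ x) (ψ z)) =ᶠ[𝓝 z]
      fun z => writtenInExtChartAt I J x ψ (extChartAt I x z) := by
    filter_upwards [hs'] with z hz
    simp only [writtenInExtChartAt, Function.comp]
    rw [(extChartAt I x).left_inv (by rwa [extChartAt_source])]
  have h₁ := mvfderiv_congr I hev (FiberBundle.extend E v z : TangentSpace I z)
  rw [mvfderiv_comp_apply_along I J he' hψ₂,
    mvfderiv_comp_apply_along I 𝓘(ℝ, E) hd.mdifferentiableAt he] at h₁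
  have h₂ : (trivializationAt F (fun y : N => TangentSpace J y) (ψ x)
      ⟨ψ z, mfderiv I J ψ z (FiberBundle.extend E v z : TangentSpace I z)⟩).2 =
      mvfderiv J (extChartAt J (ψ x)) (ψ z)
        (mfderiv I J ψ z (FiberBundle.extend E v z : TangentSpace I z)) := by
    have := congrArg (fun L : TangentSpace J (ψ z) →L[ℝ] F =>
      L (mfderiv I J ψ z (FiberBundle.extend E v z : TangentSpace I z)))
      (TangentBundle.continuousLinearMapAt_trivializationAt (I := J) ht)
    refine Eq.trans ?_ this
    exact (congrFun (Trivialization.coe_linearMapAt_of_mem (R := ℝ) _ ht) _).symm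
  have h₃ : mfderiv I 𝓘(ℝ, E) (extChartAt I x) z (FiberBundle.extend E v z : TangentSpace I z) =
      (show E from v) := by
    have := congrArg (fun L : TangentSpace I z →L[ℝ] E =>
      L (FiberBundle.extend E v z : TangentSpace I z))
      (TangentBundle.continuousLinearMapAt_trivializationAt (I := I) hs)
    refine this.symm.trans ?_
    refine (congrFun (Trivialization.coe_linearMapAt_of_mem (R := ℝ) _ hs) _).trans ?_
    simp only [FiberBundle.extend]
    rw [Trivialization.apply_mk_symm _ hs]
    exact trivializationAt_self_snd I x v
  rw [h₂, h₁, h₃]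
  exact congrArg (fun L : E →L[ℝ] F => L v) mfderiv_eq_fderiv

omit [FiniteDimensional ℝ F] [J.Boundaryless]
  [RiemannianBundle (fun y : N => TangentSpace J y)] in
theorem mdifferentiableAt_mfderiv_extend {ψ : M → N} (hψ : ContMDiff I J ∞ ψ) (x : M)
    (v : TangentSpace I x) :
    MDifferentiableAt I (J.prod 𝓘(ℝ, F)) (fun z => (TotalSpace.mk' F (ψ z)
      (mfderiv I J ψ z (FiberBundle.extend E v z : TangentSpace I z)) :
      TotalSpace F (fun y : N => TangentSpace J y))) x := by
  refine (mdifferentiableAt_along J I).2 ⟨(hψ x).mdifferentiableAt (by simp),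
    MDifferentiableAt.congr_of_eventuallyEq ?_ (trivialization_mfderiv_extend J I hψ x v)⟩
  have hd : MDifferentiableAt 𝓘(ℝ, E) 𝓘(ℝ, F)
      (fun a => fderiv ℝ (writtenInExtChartAt I J x ψ) a (show E from v)) (extChartAt I x x) :=
    ((((contDiffAt_writtenInExtChartAt J I hψ x).fderiv_right (m := 1) one_add_one_le_infty).differentiableAt
      (by simp)).clm_apply (differentiableAt_const _)).mdifferentiableAt
  exact hd.comp x (mdifferentiableAt_extChartAt (mem_chart_source H' x))

-- The chart formula, second derivative plus Christoffel term. It shows that ∇_u dψ(V) depends only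
-- on the values `u`, `v`, bilinearly and symmetrically.
omit [J.Boundaryless] in
theorem mapHessian_eq {ψ : M → N} (hψ : ContMDiff I J ∞ ψ) (x : M) (u v : TangentSpace I x) :
    mapHessian J I ψ x u v =
      (show TangentSpace J (ψ x) from fderiv ℝ (fderiv ℝ (writtenInExtChartAt I J x ψ))
        (extChartAt I x x) (show E from u) (show E from v)) +
      christoffel J (ψ x) (mfderiv I J ψ x u) (mfderiv I J ψ x v) := by
  have hd : DifferentiableAt ℝ (fderiv ℝ (writtenInExtChartAt I J x ψ)) (extChartAt I x x) :=
    ((contDiffAt_writtenInExtChartAt J I hψ x).fderiv_right (m := 1) one_add_one_le_infty).differentiableAt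
      (by simp)
  rw [mapHessian, covariantDerivAlong_eq, mvfderiv_congr I (trivialization_mfderiv_extend J I hψ x v),
    FiberBundle.extend_apply_self, mvfderiv_comp_apply_along I 𝓘(ℝ, E)
      (f := fun a => fderiv ℝ (writtenInExtChartAt I J x ψ) a (show E from v))
      (hd.clm_apply (differentiableAt_const _)).mdifferentiableAt
      (mdifferentiableAt_extChartAt (mem_chart_source H' x)), mfderiv_extChartAt_self]
  congr 1
  have h₁ : mfderiv 𝓘(ℝ, E) 𝓘(ℝ, F)
      (fun a => fderiv ℝ (writtenInExtChartAt I J x ψ) a (show E from v)) (extChartAt I x x) = _ :=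
    mfderiv_eq_fderiv
  refine (congrArg (fun L : E →L[ℝ] F => L u) h₁).trans ?_
  have h₂ := (hd.hasFDerivAt.clm_apply (hasFDerivAt_const (show E from v) (extChartAt I x x))).fderiv
  refine (congrArg (fun L : E →L[ℝ] F => L u) h₂).trans ?_
  simp
  rfl

variable [IsContMDiffRiemannianBundle J ∞ F (fun y : N => TangentSpace J y)]

theorem mapHessian_comm {ψ : M → N} (hψ : ContMDiff I J ∞ ψ) (x : M) (u v : TangentSpace I x) :
    mapHessian J I ψ x u v = mapHessian J I ψ x v u := by
  rw [mapHessian_eq J I hψ, mapHessian_eq J I hψ, christoffel_comm]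
  congr 1
  exact (contDiffAt_writtenInExtChartAt J I hψ x).isSymmSndFDerivAt (by simpa using two_le_infty) u v

theorem mapHessian_add_left {ψ : M → N} (hψ : ContMDiff I J ∞ ψ) (x : M)
    (u u' v : TangentSpace I x) :
    mapHessian J I ψ x (u + u') v = mapHessian J I ψ x u v + mapHessian J I ψ x u' v := by
  rw [mapHessian_eq J I hψ, mapHessian_eq J I hψ, mapHessian_eq J I hψ, map_add,
    christoffel_add_left, add_add_add_comm]
  congr 1
  exact congrArg (fun L : E →L[ℝ] F => L v) (ContinuousLinearMap.map_add _ _ _)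

theorem mapHessian_smul_left {ψ : M → N} (hψ : ContMDiff I J ∞ ψ) (x : M) (c : ℝ)
    (u v : TangentSpace I x) :
    mapHessian J I ψ x (c • u) v = c • mapHessian J I ψ x u v := by
  rw [mapHessian_eq J I hψ, mapHessian_eq J I hψ, map_smul, christoffel_smul_left, smul_add]
  congr 1
  exact congrArg (fun L : E →L[ℝ] F => L v) (ContinuousLinearMap.map_smul _ _ _)

end Hessian

/-! ### Second derivatives under affine substitution -/

section AffineComp

/-- The inner map has no second derivative, so the chain rule leaves a single term. In product
charts the slices p ↦ (p, q) and q ↦ (p, q) are of this kind. -/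
theorem fderiv_fderiv_comp_affine {A B F : Type*} [NormedAddCommGroup A] [NormedSpace ℝ A]
    [NormedAddCommGroup B] [NormedSpace ℝ B] [NormedAddCommGroup F] [NormedSpace ℝ F]
    (L : A →L[ℝ] B) (c : B) {g : B → F} {a : A} (hg : ContDiffAt ℝ 2 g (L a + c)) (u v : A) :
    fderiv ℝ (fderiv ℝ (fun a => g (L a + c))) a u v =
      fderiv ℝ (fderiv ℝ g) (L a + c) (L u) (L v) := by
  have hι : ∀ a, HasFDerivAt (fun a => L a + c) L a := fun a => L.hasFDerivAt.add_const c
  have hev : fderiv ℝ (fun a => g (L a + c)) =ᶠ[𝓝 a] fun a' =>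
      (fderiv ℝ g (L a' + c)).comp L := by
    have h : ∀ᶠ b in 𝓝 (L a + c), ContDiffAt ℝ 2 g b := hg.eventually (by simp)
    filter_upwards [(hι a).continuousAt.eventually h] with a' ha'
    exact ((ha'.differentiableAt (by simp)).hasFDerivAt.comp a' (hι a')).fderiv
  have hd : HasFDerivAt (fderiv ℝ g) (fderiv ℝ (fderiv ℝ g) (L a + c)) (L a + c) :=
    ((hg.fderiv_right (m := 1) (by rw [one_add_one_eq_two])).differentiableAt (by simp)).hasFDerivAt
  rw [hev.fderiv_eq]
  have h₁ := (hd.comp a (hι a)).clm_comp (hasFDerivAt_const L a)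
  refine (congrArg (fun T : A →L[ℝ] A →L[ℝ] F => T u v) h₁.fderiv).trans ?_
  simp

end AffineComp

/-! ### Coordinate vector fields -/

section Extend

variable {F : Type*} [NormedAddCommGroup F] [NormedSpace ℝ F]
  {H : Type*} [TopologicalSpace H] (J : ModelWithCorners ℝ F H)
  {N : Type*} [TopologicalSpace N] [ChartedSpace H N] [IsManifold J ∞ N]

theorem extend_zero (y : N) : ∀ᶠ z in 𝓝 y,
    (FiberBundle.extend F (0 : TangentSpace J y) z : TangentSpace J z) = 0 := by
  have h : (trivializationAt F (fun y : N => TangentSpace J y) y ⟨y, 0⟩).2 = 0 :=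
    trivializationAt_self_snd J y 0
  filter_upwards [trivialization_mem_nhds J y] with z hz
  simp only [FiberBundle.extend]
  rw [h, ← Trivialization.symmL_apply (R := ℝ) _ hz, map_zero]

theorem eq_extend_of_trivialization_eq {y z : N} {v : TangentSpace J y} {w : TangentSpace J z}
    (hz : z ∈ (trivializationAt F (fun y : N => TangentSpace J y) y).baseSet)
    (h : (trivializationAt F (fun y : N => TangentSpace J y) y ⟨z, w⟩).2 = (show F from v)) :
    w = FiberBundle.extend F v z := by
  simp only [FiberBundle.extend]
  rw [trivializationAt_self_snd, ← h, Trivialization.symm_apply_apply_mk _ hz]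

end Extend

/-! ### Slices of a product and their differentials -/

section Slices

variable {E₁ : Type*} [NormedAddCommGroup E₁] [NormedSpace ℝ E₁]
  {H₁ : Type*} [TopologicalSpace H₁] (I₁ : ModelWithCorners ℝ E₁ H₁)
  {M₁ : Type*} [TopologicalSpace M₁] [ChartedSpace H₁ M₁]
  {E₂ : Type*} [NormedAddCommGroup E₂] [NormedSpace ℝ E₂]
  {H₂ : Type*} [TopologicalSpace H₂] (I₂ : ModelWithCorners ℝ E₂ H₂)
  {M₂ : Type*} [TopologicalSpace M₂] [ChartedSpace H₂ M₂]
  {F : Type*} [NormedAddCommGroup F] [NormedSpace ℝ F]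
  {H : Type*} [TopologicalSpace H] (J : ModelWithCorners ℝ F H)
  {N : Type*} [TopologicalSpace N] [ChartedSpace H N]

/-- The inclusion of the tangent space of the first factor. -/
def inlTangent (p : M₁) (q : M₂) :
    TangentSpace I₁ p →L[ℝ] TangentSpace (I₁.prod I₂) ((p, q) : M₁ × M₂) :=
  ContinuousLinearMap.inl ℝ E₁ E₂

/-- The inclusion of the tangent space of the second factor. -/
def inrTangent (p : M₁) (q : M₂) :
    TangentSpace I₂ q →L[ℝ] TangentSpace (I₁.prod I₂) ((p, q) : M₁ × M₂) :=
  ContinuousLinearMap.inr ℝ E₁ E₂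

theorem mfderiv_slice_left {ψ : M₁ × M₂ → N} (hψ : ContMDiff (I₁.prod I₂) J ∞ ψ) (p : M₁) (q : M₂)
    (v : TangentSpace I₁ p) :
    mfderiv I₁ J (fun p => ψ (p, q)) p v = mfderiv (I₁.prod I₂) J ψ (p, q) (inlTangent I₁ I₂ p q v) := by
  have h : MDifferentiableAt I₁ (I₁.prod I₂) (fun p : M₁ => ((p, q) : M₁ × M₂)) p :=
    mdifferentiableAt_id.prodMk mdifferentiableAt_const
  have := mfderiv_comp p ((hψ (p, q)).mdifferentiableAt (by simp)) h
  refine (congrArg (fun L => L v) this).trans ?_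
  rw [mfderiv_prod_left]
  rfl

theorem mfderiv_slice_right {ψ : M₁ × M₂ → N} (hψ : ContMDiff (I₁.prod I₂) J ∞ ψ) (p : M₁) (q : M₂)
    (v : TangentSpace I₂ q) :
    mfderiv I₂ J (fun q => ψ (p, q)) q v = mfderiv (I₁.prod I₂) J ψ (p, q) (inrTangent I₁ I₂ p q v) := by
  have h : MDifferentiableAt I₂ (I₁.prod I₂) (fun q : M₂ => ((p, q) : M₁ × M₂)) q :=
    mdifferentiableAt_const.prodMk mdifferentiableAt_id
  have := mfderiv_comp q ((hψ (p, q)).mdifferentiableAt (by simp)) h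
  refine (congrArg (fun L => L v) this).trans ?_
  rw [mfderiv_prod_right]
  rfl

theorem contMDiff_slice_left {ψ : M₁ × M₂ → N} (hψ : ContMDiff (I₁.prod I₂) J ∞ ψ) (q : M₂) :
    ContMDiff I₁ J ∞ (fun p => ψ (p, q)) :=
  hψ.comp (contMDiff_id.prodMk contMDiff_const)

theorem contMDiff_slice_right {ψ : M₁ × M₂ → N} (hψ : ContMDiff (I₁.prod I₂) J ∞ ψ) (p : M₁) :
    ContMDiff I₂ J ∞ (fun q => ψ (p, q)) :=
  hψ.comp (contMDiff_const.prodMk contMDiff_id)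

end Slices

/-! ### Coordinate fields and Hessians on a product -/

section Product

variable {E₁ : Type*} [NormedAddCommGroup E₁] [NormedSpace ℝ E₁]
  {H₁ : Type*} [TopologicalSpace H₁] (I₁ : ModelWithCorners ℝ E₁ H₁) [I₁.Boundaryless]
  {M₁ : Type*} [TopologicalSpace M₁] [ChartedSpace H₁ M₁] [IsManifold I₁ ∞ M₁]
  {E₂ : Type*} [NormedAddCommGroup E₂] [NormedSpace ℝ E₂]
  {H₂ : Type*} [TopologicalSpace H₂] (I₂ : ModelWithCorners ℝ E₂ H₂) [I₂.Boundaryless]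
  {M₂ : Type*} [TopologicalSpace M₂] [ChartedSpace H₂ M₂] [IsManifold I₂ ∞ M₂]

/-- The chart of the product is the product of the charts, in which the projection is linear; hence
coordinate fields project to coordinate fields. -/
theorem mfderiv_fst_extend (x : M₁ × M₂) (v : TangentSpace (I₁.prod I₂) x) :
    ∀ᶠ z in 𝓝 x, mfderiv (I₁.prod I₂) I₁ Prod.fst z
      (FiberBundle.extend (E₁ × E₂) v z : TangentSpace (I₁.prod I₂) z) =
        FiberBundle.extend E₁ (mfderiv (I₁.prod I₂) I₁ Prod.fst x v) z.1 := by
  have hext : ContinuousAt (extChartAt (I₁.prod I₂) x) x := continuousAt_extChartAt x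
  have hw : writtenInExtChartAt (I₁.prod I₂) I₁ x (Prod.fst : M₁ × M₂ → M₁)
      =ᶠ[𝓝 (extChartAt (I₁.prod I₂) x x)] Prod.fst := by
    have ht : (extChartAt I₁ x.1).target ∈ 𝓝 (Prod.fst (extChartAt (I₁.prod I₂) x x)) := by
      simpa [extChartAt_prod] using extChartAt_target_mem_nhds (I := I₁) x.1
    filter_upwards [continuousAt_fst.preimage_mem_nhds ht] with a ha
    simp only [writtenInExtChartAt, Function.comp, extChartAt_prod]
    exact (extChartAt I₁ x.1).right_inv ha
  have hb : ∀ᶠ z in 𝓝 x, z.1 ∈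
      (trivializationAt E₁ (fun y : M₁ => TangentSpace I₁ y) x.1).baseSet :=
    continuousAt_fst.eventually (trivialization_mem_nhds I₁ x.1)
  filter_upwards [trivialization_mfderiv_extend I₁ (I₁.prod I₂)
    (contMDiff_fst : ContMDiff (I₁.prod I₂) I₁ ∞ (Prod.fst : M₁ × M₂ → M₁)) x v, hb,
    hext.eventually hw.eventuallyEq_nhds] with z hz hzb hzw
  refine eq_extend_of_trivialization_eq I₁ hzb (hz.trans ?_)
  rw [hzw.fderiv_eq, fderiv_fst, mfderiv_fst]
  rfl

theorem mfderiv_snd_extend (x : M₁ × M₂) (v : TangentSpace (I₁.prod I₂) x) :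
    ∀ᶠ z in 𝓝 x, mfderiv (I₁.prod I₂) I₂ Prod.snd z
      (FiberBundle.extend (E₁ × E₂) v z : TangentSpace (I₁.prod I₂) z) =
        FiberBundle.extend E₂ (mfderiv (I₁.prod I₂) I₂ Prod.snd x v) z.2 := by
  have hext : ContinuousAt (extChartAt (I₁.prod I₂) x) x := continuousAt_extChartAt x
  have hw : writtenInExtChartAt (I₁.prod I₂) I₂ x (Prod.snd : M₁ × M₂ → M₂)
      =ᶠ[𝓝 (extChartAt (I₁.prod I₂) x x)] Prod.snd := by
    have ht : (extChartAt I₂ x.2).target ∈ 𝓝 (Prod.snd (extChartAt (I₁.prod I₂) x x)) := by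
      simpa [extChartAt_prod] using extChartAt_target_mem_nhds (I := I₂) x.2
    filter_upwards [continuousAt_snd.preimage_mem_nhds ht] with a ha
    simp only [writtenInExtChartAt, Function.comp, extChartAt_prod]
    exact (extChartAt I₂ x.2).right_inv ha
  have hb : ∀ᶠ z in 𝓝 x, z.2 ∈
      (trivializationAt E₂ (fun y : M₂ => TangentSpace I₂ y) x.2).baseSet :=
    continuousAt_snd.eventually (trivialization_mem_nhds I₂ x.2)
  filter_upwards [trivialization_mfderiv_extend I₂ (I₁.prod I₂)
    (contMDiff_snd : ContMDiff (I₁.prod I₂) I₂ ∞ (Prod.snd : M₁ × M₂ → M₂)) x v, hb,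
    hext.eventually hw.eventuallyEq_nhds] with z hz hzb hzw
  refine eq_extend_of_trivialization_eq I₂ hzb (hz.trans ?_)
  rw [hzw.fderiv_eq, fderiv_snd, mfderiv_snd]
  rfl

variable {F : Type*} [NormedAddCommGroup F] [NormedSpace ℝ F] [FiniteDimensional ℝ F]
  {H : Type*} [TopologicalSpace H] (J : ModelWithCorners ℝ F H) [J.Boundaryless]
  {N : Type*} [TopologicalSpace N] [ChartedSpace H N] [IsManifold J ∞ N]
  [RiemannianBundle (fun y : N => TangentSpace J y)]

/-- Holds because the slice is affine in the product chart; it lets h of a slice be compared with h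
of the whole submanifold. -/
theorem mapHessian_slice_left {ψ : M₁ × M₂ → N} (hψ : ContMDiff (I₁.prod I₂) J ∞ ψ) (p : M₁) (q : M₂)
    (u v : TangentSpace I₁ p) :
    mapHessian J I₁ (fun p => ψ (p, q)) p u v =
      mapHessian J (I₁.prod I₂) ψ (p, q) (inlTangent I₁ I₂ p q u) (inlTangent I₁ I₂ p q v) := by
  rw [mapHessian_eq J I₁ (contMDiff_slice_left I₁ I₂ J hψ q), mapHessian_eq J _ hψ,
    mfderiv_slice_left I₁ I₂ J hψ, mfderiv_slice_left I₁ I₂ J hψ]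
  congr 1
  have hx : ContinuousLinearMap.inl ℝ E₁ E₂ (extChartAt I₁ p p) + (0, extChartAt I₂ q q) =
      extChartAt (I₁.prod I₂) ((p, q) : M₁ × M₂) (p, q) := by simp
  have h := fderiv_fderiv_comp_affine (ContinuousLinearMap.inl ℝ E₁ E₂) (0, extChartAt I₂ q q)
    (a := extChartAt I₁ p p) (g := writtenInExtChartAt (I₁.prod I₂) J ((p, q) : M₁ × M₂) ψ)
    (by rw [hx]; exact (contDiffAt_writtenInExtChartAt J _ hψ (p, q)).of_le two_le_infty) u v
  rw [hx] at h
  have hw : writtenInExtChartAt I₁ J p (fun p => ψ (p, q)) = fun a =>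
      writtenInExtChartAt (I₁.prod I₂) J ((p, q) : M₁ × M₂) ψ
        (ContinuousLinearMap.inl ℝ E₁ E₂ a + (0, extChartAt I₂ q q)) := by
    funext a
    simp only [writtenInExtChartAt, Function.comp, extChartAt_prod, PartialEquiv.prod_coe_symm,
      ContinuousLinearMap.inl_apply, Prod.mk_add_mk, add_zero, zero_add]
    rw [(extChartAt I₂ q).left_inv (mem_extChartAt_source q)]
  rw [hw]
  exact h

theorem mapHessian_slice_right {ψ : M₁ × M₂ → N} (hψ : ContMDiff (I₁.prod I₂) J ∞ ψ) (p : M₁) (q : M₂)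
    (u v : TangentSpace I₂ q) :
    mapHessian J I₂ (fun q => ψ (p, q)) q u v =
      mapHessian J (I₁.prod I₂) ψ (p, q) (inrTangent I₁ I₂ p q u) (inrTangent I₁ I₂ p q v) := by
  rw [mapHessian_eq J I₂ (contMDiff_slice_right I₁ I₂ J hψ p), mapHessian_eq J _ hψ,
    mfderiv_slice_right I₁ I₂ J hψ, mfderiv_slice_right I₁ I₂ J hψ]
  congr 1
  have hx : ContinuousLinearMap.inr ℝ E₁ E₂ (extChartAt I₂ q q) + (extChartAt I₁ p p, 0) =
      extChartAt (I₁.prod I₂) ((p, q) : M₁ × M₂) (p, q) := by simp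
  have h := fderiv_fderiv_comp_affine (ContinuousLinearMap.inr ℝ E₁ E₂) (extChartAt I₁ p p, 0)
    (a := extChartAt I₂ q q) (g := writtenInExtChartAt (I₁.prod I₂) J ((p, q) : M₁ × M₂) ψ)
    (by rw [hx]; exact (contDiffAt_writtenInExtChartAt J _ hψ (p, q)).of_le two_le_infty) u v
  rw [hx] at h
  have hw : writtenInExtChartAt I₂ J q (fun q => ψ (p, q)) = fun a =>
      writtenInExtChartAt (I₁.prod I₂) J ((p, q) : M₁ × M₂) ψ
        (ContinuousLinearMap.inr ℝ E₁ E₂ a + (extChartAt I₁ p p, 0)) := by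
    funext a
    simp only [writtenInExtChartAt, Function.comp, extChartAt_prod, PartialEquiv.prod_coe_symm,
      ContinuousLinearMap.inr_apply, Prod.mk_add_mk, add_zero, zero_add]
    rw [(extChartAt I₁ p).left_inv (mem_extChartAt_source p)]
  rw [hw]
  exact h

end Product

/-! ### The first derivatives of the warped product metric -/

section MetricDerivative

theorem mvfderiv_add_mul_mul {E : Type*} [NormedAddCommGroup E] [NormedSpace ℝ E]
    {H' : Type*} [TopologicalSpace H'] (I : ModelWithCorners ℝ E H') [I.Boundaryless]
    {M : Type*} [TopologicalSpace M] [ChartedSpace H' M] {a b c : M → ℝ} {x : M}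
    (ha : MDifferentiableAt I 𝓘(ℝ, ℝ) a x) (hb : MDifferentiableAt I 𝓘(ℝ, ℝ) b x)
    (hc : MDifferentiableAt I 𝓘(ℝ, ℝ) c x) (u : TangentSpace I x) :
    mvfderiv I (fun z => a z + b z * b z * c z) x u =
      mvfderiv I a x u + (b x * b x * mvfderiv I c x u + 2 * b x * mvfderiv I b x u * c x) := by
  have h := (hasDerivAt_comp_coordinateLine I ha u).add
    (((hasDerivAt_comp_coordinateLine I hb u).mul (hasDerivAt_comp_coordinateLine I hb u)).mul
      (hasDerivAt_comp_coordinateLine I hc u))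
  have hx : coordinateLine I x (show E from u) 0 = x := coordinateLine_zero I x u
  refine ((hasDerivAt_comp_coordinateLine I (ha.add ((hb.mul hb).mul hc)) u).unique h).trans ?_
  refine (congrArg (fun y => mvfderiv I a x u + ((mvfderiv I b x u * b y + b y * mvfderiv I b x u)
    * c y + b y * b y * mvfderiv I c x u)) hx).trans ?_
  ring

variable {F : Type*} [NormedAddCommGroup F] [NormedSpace ℝ F]
  {H : Type*} [TopologicalSpace H] (J : ModelWithCorners ℝ F H)
  {N : Type*} [TopologicalSpace N] [ChartedSpace H N] [IsManifold J ∞ N]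
  [RiemannianBundle (fun y : N => TangentSpace J y)]

/-- The derivative in the direction `u` of the metric coefficient `⟨V, W⟩` of two coordinate vector
fields. -/
def metricDeriv (y : N) (u v w : TangentSpace J y) : ℝ :=
  mvfderiv J (fun z : N => (inner ℝ (FiberBundle.extend F v z : TangentSpace J z)
    (FiberBundle.extend F w z : TangentSpace J z) : ℝ)) y u

theorem metricDeriv_zero_left (y : N) (v w : TangentSpace J y) : metricDeriv J y 0 v w = 0 :=
  (mvfderiv J _ y).map_zero

/-- The coordinate field with value 0 vanishes on a neighbourhood of `y`, not merely at `y`. -/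
theorem metricDeriv_zero_middle (y : N) (u w : TangentSpace J y) : metricDeriv J y u 0 w = 0 := by
  have h : (fun z : N => (inner ℝ (FiberBundle.extend F (0 : TangentSpace J y) z : TangentSpace J z)
      (FiberBundle.extend F w z : TangentSpace J z) : ℝ)) =ᶠ[𝓝 y] fun _ => 0 := by
    filter_upwards [extend_zero J y] with z hz
    rw [hz, inner_zero_left]
  rw [metricDeriv, mvfderiv_congr J h, mvfderiv_const]
  rfl

theorem metricDeriv_comm (y : N) (u v w : TangentSpace J y) :
    metricDeriv J y u v w = metricDeriv J y u w v := by
  simp only [metricDeriv, real_inner_comm]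

theorem metricDeriv_zero_right (y : N) (u v : TangentSpace J y) : metricDeriv J y u v 0 = 0 := by
  rw [metricDeriv_comm, metricDeriv_zero_middle]

theorem mdifferentiableAt_inner_extend
    [IsContMDiffRiemannianBundle J ∞ F (fun y : N => TangentSpace J y)]
    (y : N) (v w : TangentSpace J y) :
    MDifferentiableAt J 𝓘(ℝ, ℝ) (fun z : N =>
      (inner ℝ (FiberBundle.extend F v z : TangentSpace J z)
        (FiberBundle.extend F w z : TangentSpace J z) : ℝ)) y :=
  mdifferentiableAt_inner_along J (ψ := fun z : N => z)
    ((contMDiffAt_extend J y v).mdifferentiableAt (by simp))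
    ((contMDiffAt_extend J y w).mdifferentiableAt (by simp))

end MetricDerivative

/-! ### The Levi-Civita connection of the warped product -/

section Warped

variable {E₁ : Type*} [NormedAddCommGroup E₁] [NormedSpace ℝ E₁] [FiniteDimensional ℝ E₁]
  {H₁ : Type*} [TopologicalSpace H₁] (I₁ : ModelWithCorners ℝ E₁ H₁) [I₁.Boundaryless]
  {M₁ : Type*} [TopologicalSpace M₁] [ChartedSpace H₁ M₁] [IsManifold I₁ ∞ M₁]
  [RiemannianBundle (fun p : M₁ => TangentSpace I₁ p)]
  [IsContMDiffRiemannianBundle I₁ ∞ E₁ (fun p : M₁ => TangentSpace I₁ p)]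
  {E₂ : Type*} [NormedAddCommGroup E₂] [NormedSpace ℝ E₂] [FiniteDimensional ℝ E₂]
  {H₂ : Type*} [TopologicalSpace H₂] (I₂ : ModelWithCorners ℝ E₂ H₂) [I₂.Boundaryless]
  {M₂ : Type*} [TopologicalSpace M₂] [ChartedSpace H₂ M₂] [IsManifold I₂ ∞ M₂]
  [RiemannianBundle (fun q : M₂ => TangentSpace I₂ q)]
  [IsContMDiffRiemannianBundle I₂ ∞ E₂ (fun q : M₂ => TangentSpace I₂ q)]
  {F : Type*} [NormedAddCommGroup F] [NormedSpace ℝ F] [FiniteDimensional ℝ F]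
  {H : Type*} [TopologicalSpace H] (J : ModelWithCorners ℝ F H) [J.Boundaryless]
  {N : Type*} [TopologicalSpace N] [ChartedSpace H N] [IsManifold J ∞ N]
  [RiemannianBundle (fun y : N => TangentSpace J y)]
  [IsContMDiffRiemannianBundle J ∞ F (fun y : N => TangentSpace J y)]
  {f : M₁ → ℝ} {ψ : M₁ × M₂ → N}

/-- The isometry condition on coordinate fields near `x`; each term involves fields on one factor
only, so it can be differentiated factor by factor. -/
theorem IsWarpedProductSubmanifold.inner_mfderiv_extend
    (hM : IsWarpedProductSubmanifold I₁ I₂ J f ψ) (x : M₁ × M₂)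
    (v w : TangentSpace (I₁.prod I₂) x) :
    (fun z => (inner ℝ
      (mfderiv (I₁.prod I₂) J ψ z
        (FiberBundle.extend (E₁ × E₂) v z : TangentSpace (I₁.prod I₂) z))
      (mfderiv (I₁.prod I₂) J ψ z
        (FiberBundle.extend (E₁ × E₂) w z : TangentSpace (I₁.prod I₂) z)) : ℝ)) =ᶠ[𝓝 x] fun z =>
      (inner ℝ (FiberBundle.extend E₁ (mfderiv (I₁.prod I₂) I₁ Prod.fst x v) z.1 : TangentSpace I₁ z.1)
        (FiberBundle.extend E₁ (mfderiv (I₁.prod I₂) I₁ Prod.fst x w) z.1 : TangentSpace I₁ z.1) : ℝ) +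
      f z.1 * f z.1 *
      (inner ℝ (FiberBundle.extend E₂ (mfderiv (I₁.prod I₂) I₂ Prod.snd x v) z.2 : TangentSpace I₂ z.2)
        (FiberBundle.extend E₂ (mfderiv (I₁.prod I₂) I₂ Prod.snd x w) z.2 : TangentSpace I₂ z.2) : ℝ) := by
  filter_upwards [mfderiv_fst_extend I₁ I₂ x v, mfderiv_fst_extend I₁ I₂ x w,
    mfderiv_snd_extend I₁ I₂ x v, mfderiv_snd_extend I₁ I₂ x w] with z h₁ h₂ h₃ h₄
  have h := hM.isometric z (FiberBundle.extend (E₁ × E₂) v z) (FiberBundle.extend (E₁ × E₂) w z)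
  rw [warpedMetric, h₁, h₂, h₃, h₄, pow_two] at h
  exact h

/-- The derivative of the warped product metric. -/
theorem IsWarpedProductSubmanifold.mvfderiv_inner
    (hM : IsWarpedProductSubmanifold I₁ I₂ J f ψ) (x : M₁ × M₂)
    (u v w : TangentSpace (I₁.prod I₂) x) :
    mvfderiv (I₁.prod I₂) (fun z => (inner ℝ
      (mfderiv (I₁.prod I₂) J ψ z
        (FiberBundle.extend (E₁ × E₂) v z : TangentSpace (I₁.prod I₂) z))
      (mfderiv (I₁.prod I₂) J ψ z
        (FiberBundle.extend (E₁ × E₂) w z : TangentSpace (I₁.prod I₂) z)) : ℝ)) x u =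
      metricDeriv I₁ x.1 (mfderiv (I₁.prod I₂) I₁ Prod.fst x u)
        (mfderiv (I₁.prod I₂) I₁ Prod.fst x v) (mfderiv (I₁.prod I₂) I₁ Prod.fst x w) +
      (f x.1 * f x.1 * metricDeriv I₂ x.2 (mfderiv (I₁.prod I₂) I₂ Prod.snd x u)
        (mfderiv (I₁.prod I₂) I₂ Prod.snd x v) (mfderiv (I₁.prod I₂) I₂ Prod.snd x w) +
      2 * f x.1 * mvfderiv I₁ f x.1 (mfderiv (I₁.prod I₂) I₁ Prod.fst x u) *
        inner ℝ (mfderiv (I₁.prod I₂) I₂ Prod.snd x v) (mfderiv (I₁.prod I₂) I₂ Prod.snd x w)) := by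
  have hfst : MDifferentiableAt (I₁.prod I₂) I₁ (Prod.fst : M₁ × M₂ → M₁) x := mdifferentiableAt_fst
  have hsnd : MDifferentiableAt (I₁.prod I₂) I₂ (Prod.snd : M₁ × M₂ → M₂) x := mdifferentiableAt_snd
  have hf : MDifferentiableAt I₁ 𝓘(ℝ, ℝ) f x.1 := (hM.smooth_f x.1).mdifferentiableAt (by simp)
  have hf' : MDifferentiableAt (I₁.prod I₂) 𝓘(ℝ, ℝ) (fun z : M₁ × M₂ => f z.1) x := hf.comp x hfst
  have hi₁ := mdifferentiableAt_inner_extend I₁ x.1 (mfderiv (I₁.prod I₂) I₁ Prod.fst x v)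
    (mfderiv (I₁.prod I₂) I₁ Prod.fst x w)
  have hi₂ := mdifferentiableAt_inner_extend I₂ x.2 (mfderiv (I₁.prod I₂) I₂ Prod.snd x v)
    (mfderiv (I₁.prod I₂) I₂ Prod.snd x w)
  rw [mvfderiv_congr _ (hM.inner_mfderiv_extend I₁ I₂ J x v w)]
  refine (mvfderiv_add_mul_mul _ (hi₁.comp x hfst) hf' (hi₂.comp x hsnd) u).trans ?_
  have e₁ := mvfderiv_comp_apply_along (I₁.prod I₂) I₁ hi₁ hfst u
  have e₂ := mvfderiv_comp_apply_along (I₁.prod I₂) I₂ hi₂ hsnd u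
  have e₃ := mvfderiv_comp_apply_along (I₁.prod I₂) I₁ hf hfst u
  simp only [Function.comp_def]
  rw [e₁, e₂, e₃, FiberBundle.extend_apply_self, FiberBundle.extend_apply_self]
  rfl

/-- The Koszul formula for an isometric immersion of a warped product. -/
theorem IsWarpedProductSubmanifold.two_mul_inner_mapHessian
    (hM : IsWarpedProductSubmanifold I₁ I₂ J f ψ) (x : M₁ × M₂)
    (u v w : TangentSpace (I₁.prod I₂) x) :
    2 * (inner ℝ (mapHessian J (I₁.prod I₂) ψ x u v) (mfderiv (I₁.prod I₂) J ψ x w) : ℝ) =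
      mvfderiv (I₁.prod I₂) (fun z => (inner ℝ
        (mfderiv (I₁.prod I₂) J ψ z (FiberBundle.extend (E₁ × E₂) v z : TangentSpace (I₁.prod I₂) z))
        (mfderiv (I₁.prod I₂) J ψ z
          (FiberBundle.extend (E₁ × E₂) w z : TangentSpace (I₁.prod I₂) z)) : ℝ)) x u +
      mvfderiv (I₁.prod I₂) (fun z => (inner ℝ
        (mfderiv (I₁.prod I₂) J ψ z (FiberBundle.extend (E₁ × E₂) u z : TangentSpace (I₁.prod I₂) z))
        (mfderiv (I₁.prod I₂) J ψ z
          (FiberBundle.extend (E₁ × E₂) w z : TangentSpace (I₁.prod I₂) z)) : ℝ)) x v -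
      mvfderiv (I₁.prod I₂) (fun z => (inner ℝ
        (mfderiv (I₁.prod I₂) J ψ z (FiberBundle.extend (E₁ × E₂) u z : TangentSpace (I₁.prod I₂) z))
        (mfderiv (I₁.prod I₂) J ψ z
          (FiberBundle.extend (E₁ × E₂) v z : TangentSpace (I₁.prod I₂) z)) : ℝ)) x w := by
  have hd := mdifferentiableAt_mfderiv_extend J (I₁.prod I₂) hM.smooth x
  rw [mvfderiv_inner_along J _ (hd v) (hd w), mvfderiv_inner_along J _ (hd u) (hd w),
    mvfderiv_inner_along J _ (hd u) (hd v), FiberBundle.extend_apply_self,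
    FiberBundle.extend_apply_self, FiberBundle.extend_apply_self]
  have hB : ∀ a b, covariantDerivAlong J (I₁.prod I₂) ψ
      (fun z => mfderiv (I₁.prod I₂) J ψ z
        (FiberBundle.extend (E₁ × E₂) b z : TangentSpace (I₁.prod I₂) z)) x a =
      mapHessian J (I₁.prod I₂) ψ x a b := fun a b => rfl
  simp only [hB]
  -- By symmetry of the Hessian four of the six terms cancel, leaving ⟨∇_u V, w⟩ twice.
  rw [mapHessian_comm J _ hM.smooth x v u, mapHessian_comm J _ hM.smooth x w u,
    mapHessian_comm J _ hM.smooth x w v, real_inner_comm _ (mapHessian J (I₁.prod I₂) ψ x u w)]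
  ring

theorem mfderiv_fst_inlTangent (p : M₁) (q : M₂) (a : TangentSpace I₁ p) :
    mfderiv (I₁.prod I₂) I₁ Prod.fst ((p, q) : M₁ × M₂) (inlTangent I₁ I₂ p q a) = a := by
  rw [mfderiv_fst]
  rfl

theorem mfderiv_snd_inlTangent (p : M₁) (q : M₂) (a : TangentSpace I₁ p) :
    mfderiv (I₁.prod I₂) I₂ Prod.snd ((p, q) : M₁ × M₂) (inlTangent I₁ I₂ p q a) = 0 := by
  rw [mfderiv_snd]
  rfl

theorem mfderiv_fst_inrTangent (p : M₁) (q : M₂) (b : TangentSpace I₂ q) :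
    mfderiv (I₁.prod I₂) I₁ Prod.fst ((p, q) : M₁ × M₂) (inrTangent I₁ I₂ p q b) = 0 := by
  rw [mfderiv_fst]
  rfl

theorem mfderiv_snd_inrTangent (p : M₁) (q : M₂) (b : TangentSpace I₂ q) :
    mfderiv (I₁.prod I₂) I₂ Prod.snd ((p, q) : M₁ × M₂) (inrTangent I₁ I₂ p q b) = b := by
  rw [mfderiv_snd]
  rfl

theorem IsWarpedProductSubmanifold.inner_inl_inl (hM : IsWarpedProductSubmanifold I₁ I₂ J f ψ)
    (p : M₁) (q : M₂) (a a' : TangentSpace I₁ p) :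
    (inner ℝ (mfderiv (I₁.prod I₂) J ψ (p, q) (inlTangent I₁ I₂ p q a))
      (mfderiv (I₁.prod I₂) J ψ (p, q) (inlTangent I₁ I₂ p q a')) : ℝ) = inner ℝ a a' := by
  have h := hM.isometric (p, q) (inlTangent I₁ I₂ p q a) (inlTangent I₁ I₂ p q a')
  rw [warpedMetric, mfderiv_fst_inlTangent, mfderiv_fst_inlTangent, mfderiv_snd_inlTangent,
    inner_zero_left, mul_zero, add_zero] at h
  exact h

theorem IsWarpedProductSubmanifold.inner_inl_inr (hM : IsWarpedProductSubmanifold I₁ I₂ J f ψ)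
    (p : M₁) (q : M₂) (a : TangentSpace I₁ p) (b : TangentSpace I₂ q) :
    (inner ℝ (mfderiv (I₁.prod I₂) J ψ (p, q) (inlTangent I₁ I₂ p q a))
      (mfderiv (I₁.prod I₂) J ψ (p, q) (inrTangent I₁ I₂ p q b)) : ℝ) = 0 := by
  have h := hM.isometric (p, q) (inlTangent I₁ I₂ p q a) (inrTangent I₁ I₂ p q b)
  rw [warpedMetric, mfderiv_fst_inlTangent, mfderiv_fst_inrTangent, mfderiv_snd_inlTangent,
    inner_zero_left, inner_zero_right, mul_zero, add_zero] at h
  exact h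

theorem IsWarpedProductSubmanifold.inner_inr_inr (hM : IsWarpedProductSubmanifold I₁ I₂ J f ψ)
    (p : M₁) (q : M₂) (b b' : TangentSpace I₂ q) :
    (inner ℝ (mfderiv (I₁.prod I₂) J ψ (p, q) (inrTangent I₁ I₂ p q b))
      (mfderiv (I₁.prod I₂) J ψ (p, q) (inrTangent I₁ I₂ p q b')) : ℝ) =
      f p ^ 2 * inner ℝ b b' := by
  have h := hM.isometric (p, q) (inrTangent I₁ I₂ p q b) (inrTangent I₁ I₂ p q b')
  rw [warpedMetric, mfderiv_fst_inrTangent, mfderiv_snd_inrTangent, mfderiv_snd_inrTangent,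
    inner_zero_left, zero_add] at h
  exact h

theorem IsWarpedProductSubmanifold.inner_gradient_log (hM : IsWarpedProductSubmanifold I₁ I₂ J f ψ)
    (p : M₁) (a : TangentSpace I₁ p) :
    (inner ℝ (gradient I₁ (fun p => Real.log (f p)) p) a : ℝ) = mvfderiv I₁ f p a / f p := by
  have hf : MDifferentiableAt I₁ 𝓘(ℝ, ℝ) f p := (hM.smooth_f p).mdifferentiableAt (by simp)
  have : CompleteSpace (TangentSpace I₁ p) := FiniteDimensional.complete ℝ _
  have hlog := Real.hasDerivAt_log (hM.pos_f p).ne'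
  rw [gradient, InnerProductSpace.toDual_symm_apply,
    mvfderiv_comp_apply_along I₁ 𝓘(ℝ, ℝ) hlog.differentiableAt.mdifferentiableAt hf]
  refine (congrArg (fun L : ℝ →L[ℝ] ℝ => L (mvfderiv I₁ f p a))
    (mfderiv_eq_fderiv.trans hlog.hasFDerivAt.fderiv)).trans ?_
  simp [div_eq_mul_inv]

theorem IsWarpedProductSubmanifold.two_mul_inner_mapHessian_eq
    (hM : IsWarpedProductSubmanifold I₁ I₂ J f ψ) (p : M₁) (q : M₂)
    (u v w : TangentSpace (I₁.prod I₂) ((p, q) : M₁ × M₂))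
    {u₁ v₁ w₁ : TangentSpace I₁ p} {u₂ v₂ w₂ : TangentSpace I₂ q}
    (hu₁ : mfderiv (I₁.prod I₂) I₁ Prod.fst (p, q) u = u₁)
    (hu₂ : mfderiv (I₁.prod I₂) I₂ Prod.snd (p, q) u = u₂)
    (hv₁ : mfderiv (I₁.prod I₂) I₁ Prod.fst (p, q) v = v₁)
    (hv₂ : mfderiv (I₁.prod I₂) I₂ Prod.snd (p, q) v = v₂)
    (hw₁ : mfderiv (I₁.prod I₂) I₁ Prod.fst (p, q) w = w₁)
    (hw₂ : mfderiv (I₁.prod I₂) I₂ Prod.snd (p, q) w = w₂) :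
    2 * (inner ℝ (mapHessian J (I₁.prod I₂) ψ (p, q) u v) (mfderiv (I₁.prod I₂) J ψ (p, q) w) : ℝ) =
      (metricDeriv I₁ p u₁ v₁ w₁ + (f p * f p * metricDeriv I₂ q u₂ v₂ w₂ +
        2 * f p * mvfderiv I₁ f p u₁ * inner ℝ v₂ w₂)) +
      (metricDeriv I₁ p v₁ u₁ w₁ + (f p * f p * metricDeriv I₂ q v₂ u₂ w₂ +
        2 * f p * mvfderiv I₁ f p v₁ * inner ℝ u₂ w₂)) -
      (metricDeriv I₁ p w₁ u₁ v₁ + (f p * f p * metricDeriv I₂ q w₂ u₂ v₂ +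
        2 * f p * mvfderiv I₁ f p w₁ * inner ℝ u₂ v₂)) := by
  subst hu₁ hu₂ hv₁ hv₂ hw₁ hw₂
  rw [hM.two_mul_inner_mapHessian I₁ I₂ J, hM.mvfderiv_inner I₁ I₂ J, hM.mvfderiv_inner I₁ I₂ J,
    hM.mvfderiv_inner I₁ I₂ J]

/-- Every term of the Koszul formula has a zero argument: M_T is totally geodesic inside M. -/
theorem IsWarpedProductSubmanifold.inner_mapHessian_inl_inl_inr
    (hM : IsWarpedProductSubmanifold I₁ I₂ J f ψ) (p : M₁) (q : M₂) (a a' : TangentSpace I₁ p)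
    (b : TangentSpace I₂ q) :
    (inner ℝ (mapHessian J (I₁.prod I₂) ψ (p, q) (inlTangent I₁ I₂ p q a) (inlTangent I₁ I₂ p q a'))
      (mfderiv (I₁.prod I₂) J ψ (p, q) (inrTangent I₁ I₂ p q b)) : ℝ) = 0 := by
  have h := hM.two_mul_inner_mapHessian_eq I₁ I₂ J p q (inlTangent I₁ I₂ p q a)
    (inlTangent I₁ I₂ p q a') (inrTangent I₁ I₂ p q b)
    (mfderiv_fst_inlTangent I₁ I₂ p q _) (mfderiv_snd_inlTangent I₁ I₂ p q _)
    (mfderiv_fst_inlTangent I₁ I₂ p q _) (mfderiv_snd_inlTangent I₁ I₂ p q _)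
    (mfderiv_fst_inrTangent I₁ I₂ p q _) (mfderiv_snd_inrTangent I₁ I₂ p q _)
  simp only [metricDeriv_zero_left, metricDeriv_zero_middle,
    metricDeriv_zero_right, inner_zero_left, inner_zero_right, ContinuousLinearMap.map_zero, mul_zero, add_zero, sub_zero] at h
  linarith

/-- Only the derivative of f² in the direction `a` survives; this is the M_θ part of ∇_X Z = X(ln f)
Z. -/
theorem IsWarpedProductSubmanifold.inner_mapHessian_inl_inr_inr
    (hM : IsWarpedProductSubmanifold I₁ I₂ J f ψ) (p : M₁) (q : M₂) (a : TangentSpace I₁ p)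
    (b b' : TangentSpace I₂ q) :
    (inner ℝ (mapHessian J (I₁.prod I₂) ψ (p, q) (inlTangent I₁ I₂ p q a) (inrTangent I₁ I₂ p q b))
      (mfderiv (I₁.prod I₂) J ψ (p, q) (inrTangent I₁ I₂ p q b')) : ℝ) =
      inner ℝ (gradient I₁ (fun p => Real.log (f p)) p) a * (f p ^ 2 * inner ℝ b b') := by
  have h := hM.two_mul_inner_mapHessian_eq I₁ I₂ J p q (inlTangent I₁ I₂ p q a)
    (inrTangent I₁ I₂ p q b) (inrTangent I₁ I₂ p q b')
    (mfderiv_fst_inlTangent I₁ I₂ p q _) (mfderiv_snd_inlTangent I₁ I₂ p q _)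
    (mfderiv_fst_inrTangent I₁ I₂ p q _) (mfderiv_snd_inrTangent I₁ I₂ p q _)
    (mfderiv_fst_inrTangent I₁ I₂ p q _) (mfderiv_snd_inrTangent I₁ I₂ p q _)
  simp only [metricDeriv_zero_left, metricDeriv_zero_middle,
    metricDeriv_zero_right, inner_zero_left, ContinuousLinearMap.map_zero, mul_zero, add_zero, sub_zero, zero_add] at h
  rw [hM.inner_gradient_log I₁ I₂ J]
  have := (hM.pos_f p).ne'
  field_simp
  linarith

/-- The derivative of f² now comes from the subtracted term of the Koszul formula, hence the sign:
inside M, the factor M_θ is umbilical with mean curvature vector −∇ ln f. -/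
theorem IsWarpedProductSubmanifold.inner_mapHessian_inr_inr_inl
    (hM : IsWarpedProductSubmanifold I₁ I₂ J f ψ) (p : M₁) (q : M₂) (a : TangentSpace I₁ p)
    (b b' : TangentSpace I₂ q) :
    (inner ℝ (mapHessian J (I₁.prod I₂) ψ (p, q) (inrTangent I₁ I₂ p q b) (inrTangent I₁ I₂ p q b'))
      (mfderiv (I₁.prod I₂) J ψ (p, q) (inlTangent I₁ I₂ p q a)) : ℝ) =
      -(inner ℝ (gradient I₁ (fun p => Real.log (f p)) p) a * (f p ^ 2 * inner ℝ b b')) := by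
  have h := hM.two_mul_inner_mapHessian_eq I₁ I₂ J p q (inrTangent I₁ I₂ p q b)
    (inrTangent I₁ I₂ p q b') (inlTangent I₁ I₂ p q a)
    (mfderiv_fst_inrTangent I₁ I₂ p q _) (mfderiv_snd_inrTangent I₁ I₂ p q _)
    (mfderiv_fst_inrTangent I₁ I₂ p q _) (mfderiv_snd_inrTangent I₁ I₂ p q _)
    (mfderiv_fst_inlTangent I₁ I₂ p q _) (mfderiv_snd_inlTangent I₁ I₂ p q _)
  simp only [metricDeriv_zero_left, metricDeriv_zero_middle,
    metricDeriv_zero_right, inner_zero_right, ContinuousLinearMap.map_zero, mul_zero, add_zero, zero_add] at h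
  rw [hM.inner_gradient_log I₁ I₂ J]
  have := (hM.pos_f p).ne'
  field_simp
  linarith

end Warped

/-! ### Almost contact metric structures -/

section Contact

variable {F : Type*} [NormedAddCommGroup F] [NormedSpace ℝ F] [FiniteDimensional ℝ F]
  {H : Type*} [TopologicalSpace H] {J : ModelWithCorners ℝ F H}
  {N : Type*} [TopologicalSpace N] [ChartedSpace H N] [IsManifold J ∞ N]
  [RiemannianBundle (fun y : N => TangentSpace J y)]
  {φ : ∀ y : N, TangentSpace J y →L[ℝ] TangentSpace J y}
  {ξ : ∀ y : N, TangentSpace J y} {η : ∀ y : N, TangentSpace J y →L[ℝ] ℝ}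

theorem IsAlmostContactMetric.eta_eq (h : IsAlmostContactMetric J φ ξ η) (y : N)
    (v : TangentSpace J y) : η y v = inner ℝ (ξ y) v := by
  have := h.inner_phi_phi y v (ξ y)
  rw [h.phi_xi, inner_zero_right, h.eta_xi, mul_one, real_inner_comm] at this
  linarith

/-- Apply the compatibility of `φ` with the metric to `φ v` and `w`; the `η` terms vanish since η ∘
φ = 0. -/
theorem IsAlmostContactMetric.inner_phi_left (h : IsAlmostContactMetric J φ ξ η) (y : N)
    (v w : TangentSpace J y) : (inner ℝ (φ y v) w : ℝ) = -inner ℝ v (φ y w) := by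
  have := h.inner_phi_phi y (φ y v) w
  rw [h.phi_phi, h.eta_phi, inner_add_left, inner_neg_left, real_inner_smul_left, ← h.eta_eq,
    h.eta_phi] at this
  linarith

end Contact

/-! ### First order consequences of the Kenmotsu and semi-slant conditions -/

section SemiSlant

variable {E₁ : Type*} [NormedAddCommGroup E₁] [NormedSpace ℝ E₁] [FiniteDimensional ℝ E₁]
  {H₁ : Type*} [TopologicalSpace H₁] (I₁ : ModelWithCorners ℝ E₁ H₁) [I₁.Boundaryless]
  {M₁ : Type*} [TopologicalSpace M₁] [ChartedSpace H₁ M₁] [IsManifold I₁ ∞ M₁]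
  [RiemannianBundle (fun p : M₁ => TangentSpace I₁ p)]
  [IsContMDiffRiemannianBundle I₁ ∞ E₁ (fun p : M₁ => TangentSpace I₁ p)]
  {E₂ : Type*} [NormedAddCommGroup E₂] [NormedSpace ℝ E₂] [FiniteDimensional ℝ E₂]
  {H₂ : Type*} [TopologicalSpace H₂] (I₂ : ModelWithCorners ℝ E₂ H₂) [I₂.Boundaryless]
  {M₂ : Type*} [TopologicalSpace M₂] [ChartedSpace H₂ M₂] [IsManifold I₂ ∞ M₂]
  [RiemannianBundle (fun q : M₂ => TangentSpace I₂ q)]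
  [IsContMDiffRiemannianBundle I₂ ∞ E₂ (fun q : M₂ => TangentSpace I₂ q)]
  {F : Type*} [NormedAddCommGroup F] [NormedSpace ℝ F] [FiniteDimensional ℝ F]
  {H : Type*} [TopologicalSpace H] (J : ModelWithCorners ℝ F H) [J.Boundaryless]
  {N : Type*} [TopologicalSpace N] [ChartedSpace H N] [IsManifold J ∞ N]
  [RiemannianBundle (fun y : N => TangentSpace J y)]
  [IsContMDiffRiemannianBundle J ∞ F (fun y : N => TangentSpace J y)]
  {f : M₁ → ℝ} {ψ : M₁ × M₂ → N}
  {φ : ∀ y : N, TangentSpace J y →L[ℝ] TangentSpace J y}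
  {ξ : ∀ y : N, TangentSpace J y} {η : ∀ y : N, TangentSpace J y →L[ℝ] ℝ} {θ : ℝ}

theorem inlTangent_add_inrTangent (p : M₁) (q : M₂)
    (u : TangentSpace (I₁.prod I₂) ((p, q) : M₁ × M₂)) :
    inlTangent I₁ I₂ p q (mfderiv (I₁.prod I₂) I₁ Prod.fst (p, q) u) +
      inrTangent I₁ I₂ p q (mfderiv (I₁.prod I₂) I₂ Prod.snd (p, q) u) = u := by
  rw [mfderiv_fst, mfderiv_snd]
  have h : ∀ w : E₁ × E₂, ((w.1, 0) : E₁ × E₂) + (0, w.2) = w := by simp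
  exact h u

theorem eq_inlTangent (p : M₁) (q : M₂) (u : TangentSpace (I₁.prod I₂) ((p, q) : M₁ × M₂))
    (h : mfderiv (I₁.prod I₂) I₂ Prod.snd (p, q) u = 0) :
    u = inlTangent I₁ I₂ p q (mfderiv (I₁.prod I₂) I₁ Prod.fst (p, q) u) := by
  have h' := inlTangent_add_inrTangent I₁ I₂ p q u
  rw [h, ContinuousLinearMap.map_zero, add_zero] at h'
  exact h'.symm

theorem eq_inrTangent (p : M₁) (q : M₂) (u : TangentSpace (I₁.prod I₂) ((p, q) : M₁ × M₂))
    (h : mfderiv (I₁.prod I₂) I₁ Prod.fst (p, q) u = 0) :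
    u = inrTangent I₁ I₂ p q (mfderiv (I₁.prod I₂) I₂ Prod.snd (p, q) u) := by
  have h' := inlTangent_add_inrTangent I₁ I₂ p q u
  rw [h, ContinuousLinearMap.map_zero, zero_add] at h'
  exact h'.symm

/-- The second projection of this field is the coordinate field of 0, hence zero nearby. Thus
orthogonality relations between the factors hold on a neighbourhood and may be differentiated. -/
theorem extend_inlTangent (p : M₁) (q : M₂) (a : TangentSpace I₁ p) :
    ∀ᶠ z : M₁ × M₂ in 𝓝 (p, q), ∃ c : TangentSpace I₁ z.1,
      FiberBundle.extend (E₁ × E₂) (inlTangent I₁ I₂ p q a) z = inlTangent I₁ I₂ z.1 z.2 c := by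
  have h := mfderiv_snd_extend I₁ I₂ (p, q) (inlTangent I₁ I₂ p q a)
  have h0 : ∀ᶠ z : M₁ × M₂ in 𝓝 (p, q),
      FiberBundle.extend E₂ (0 : TangentSpace I₂ q) z.2 = 0 :=
    by
    have := (continuous_snd.tendsto ((p, q) : M₁ × M₂)).eventually (extend_zero I₂ q)
    exact this
  filter_upwards [h, h0] with z h h0
  rw [mfderiv_snd_inlTangent, h0] at h
  exact ⟨_, eq_inlTangent I₁ I₂ z.1 z.2 _ h⟩

theorem extend_inrTangent (p : M₁) (q : M₂) (b : TangentSpace I₂ q) :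
    ∀ᶠ z : M₁ × M₂ in 𝓝 (p, q), ∃ c : TangentSpace I₂ z.2,
      FiberBundle.extend (E₁ × E₂) (inrTangent I₁ I₂ p q b) z = inrTangent I₁ I₂ z.1 z.2 c := by
  have h := mfderiv_fst_extend I₁ I₂ (p, q) (inrTangent I₁ I₂ p q b)
  have h0 : ∀ᶠ z : M₁ × M₂ in 𝓝 (p, q),
      FiberBundle.extend E₁ (0 : TangentSpace I₁ p) z.1 = 0 :=
    by
    have := (continuous_fst.tendsto ((p, q) : M₁ × M₂)).eventually (extend_zero I₁ p)
    exact this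
  filter_upwards [h, h0] with z h h0
  rw [mfderiv_fst_inrTangent, h0] at h
  exact ⟨_, eq_inrTangent I₁ I₂ z.1 z.2 _ h⟩

theorem IsProperWarpedProductSemiSlant.exists_xi_eq
    (hM : IsProperWarpedProductSemiSlant I₁ I₂ J φ ξ θ f ψ) (p : M₁) (q : M₂) :
    ∃ c : TangentSpace I₁ p,
      mfderiv (I₁.prod I₂) J ψ (p, q) (inlTangent I₁ I₂ p q c) = ξ (ψ (p, q)) := by
  obtain ⟨c, hc⟩ := hM.xi_tangent q p
  exact ⟨c, (mfderiv_slice_left I₁ I₂ J hM.smooth p q c).symm.trans hc⟩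

theorem IsProperWarpedProductSemiSlant.exists_phi_eq
    (hM : IsProperWarpedProductSemiSlant I₁ I₂ J φ ξ θ f ψ) (p : M₁) (q : M₂)
    (a : TangentSpace I₁ p) :
    ∃ c : TangentSpace I₁ p, mfderiv (I₁.prod I₂) J ψ (p, q) (inlTangent I₁ I₂ p q c) =
      φ (ψ (p, q)) (mfderiv (I₁.prod I₂) J ψ (p, q) (inlTangent I₁ I₂ p q a)) := by
  obtain ⟨c, hc⟩ := hM.invariant q p (mfderiv (I₁.prod I₂) J ψ (p, q) (inlTangent I₁ I₂ p q a))
    ⟨a, mfderiv_slice_left I₁ I₂ J hM.smooth p q a⟩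
  exact ⟨c, (mfderiv_slice_left I₁ I₂ J hM.smooth p q c).symm.trans hc⟩

theorem IsProperWarpedProductSemiSlant.inner_xi_inr
    (hM : IsProperWarpedProductSemiSlant I₁ I₂ J φ ξ θ f ψ) (p : M₁) (q : M₂)
    (b : TangentSpace I₂ q) :
    (inner ℝ (ξ (ψ (p, q)))
      (mfderiv (I₁.prod I₂) J ψ (p, q) (inrTangent I₁ I₂ p q b)) : ℝ) = 0 := by
  obtain ⟨c, hc⟩ := hM.exists_xi_eq I₁ I₂ J p q
  rw [← hc]
  exact hM.inner_inl_inr I₁ I₂ J p q c b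

theorem IsProperWarpedProductSemiSlant.inner_phi_inl_inr
    (hM : IsProperWarpedProductSemiSlant I₁ I₂ J φ ξ θ f ψ) (p : M₁) (q : M₂)
    (a : TangentSpace I₁ p) (b : TangentSpace I₂ q) :
    (inner ℝ (φ (ψ (p, q)) (mfderiv (I₁.prod I₂) J ψ (p, q) (inlTangent I₁ I₂ p q a)))
      (mfderiv (I₁.prod I₂) J ψ (p, q) (inrTangent I₁ I₂ p q b)) : ℝ) = 0 := by
  obtain ⟨c, hc⟩ := hM.exists_phi_eq I₁ I₂ J p q a
  rw [← hc]
  exact hM.inner_inl_inr I₁ I₂ J p q c b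

/-- The derivative of `⟨φ V, W⟩ = 0`, for `V` tangent to the first and `W` to the second factor. -/
theorem IsProperWarpedProductSemiSlant.inner_mapHessian_phi
    (hM : IsProperWarpedProductSemiSlant I₁ I₂ J φ ξ θ f ψ) (hN : IsKenmotsu J φ ξ η)
    (p : M₁) (q : M₂) (u : TangentSpace (I₁.prod I₂) ((p, q) : M₁ × M₂))
    (a : TangentSpace I₁ p) (b : TangentSpace I₂ q) :
    (inner ℝ (mapHessian J (I₁.prod I₂) ψ (p, q) u (inlTangent I₁ I₂ p q a))
      (φ (ψ (p, q)) (mfderiv (I₁.prod I₂) J ψ (p, q) (inrTangent I₁ I₂ p q b))) : ℝ) =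
    inner ℝ (mapHessian J (I₁.prod I₂) ψ (p, q) u (inrTangent I₁ I₂ p q b))
      (φ (ψ (p, q)) (mfderiv (I₁.prod I₂) J ψ (p, q) (inlTangent I₁ I₂ p q a))) -
    inner ℝ (ξ (ψ (p, q))) (mfderiv (I₁.prod I₂) J ψ (p, q) (inlTangent I₁ I₂ p q a)) *
      inner ℝ (φ (ψ (p, q)) (mfderiv (I₁.prod I₂) J ψ (p, q) u))
        (mfderiv (I₁.prod I₂) J ψ (p, q) (inrTangent I₁ I₂ p q b)) := by
  have hd := mdifferentiableAt_mfderiv_extend J (I₁.prod I₂) hM.smooth (p, q)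
  obtain ⟨hd', hcov⟩ := hN.nabla_phi_along J _ (hd (inlTangent I₁ I₂ p q a)) u
  have h := mvfderiv_inner_along J _ hd' (hd (inrTangent I₁ I₂ p q b)) u
  -- By invariance φV stays tangent to the first factor, so this function vanishes near the point.
  have h0 : (fun z : M₁ × M₂ => (inner ℝ
      (φ (ψ z) (mfderiv (I₁.prod I₂) J ψ z (FiberBundle.extend (E₁ × E₂)
        (inlTangent I₁ I₂ p q a) z : TangentSpace (I₁.prod I₂) z)))
      (mfderiv (I₁.prod I₂) J ψ z (FiberBundle.extend (E₁ × E₂)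
        (inrTangent I₁ I₂ p q b) z : TangentSpace (I₁.prod I₂) z)) : ℝ)) =ᶠ[𝓝 (p, q)]
      fun _ => 0 := by
    filter_upwards [extend_inlTangent I₁ I₂ p q a, extend_inrTangent I₁ I₂ p q b] with z hz hz'
    obtain ⟨c, hc⟩ := hz
    obtain ⟨c', hc'⟩ := hz'
    rw [hc, hc']
    exact hM.inner_phi_inl_inr I₁ I₂ J z.1 z.2 c c'
  rw [mvfderiv_congr _ h0, mvfderiv_const, hcov, FiberBundle.extend_apply_self,
    FiberBundle.extend_apply_self, inner_sub_left, inner_add_left, real_inner_smul_left,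
    real_inner_smul_left, hM.inner_xi_inr I₁ I₂ J, hN.inner_phi_left, hN.eta_eq] at h
  have h' : (0 : ℝ) = _ := h
  rw [real_inner_comm _ (mapHessian J (I₁.prod I₂) ψ (p, q) u (inrTangent I₁ I₂ p q b))]
  change (inner ℝ (covariantDerivAlong J (I₁.prod I₂) ψ _ (p, q) u) _ : ℝ) =
    inner ℝ _ (covariantDerivAlong J (I₁.prod I₂) ψ _ (p, q) u) - _
  linarith

/-- The M_θ component of ∇_u ξ = u − η(u) ξ. Differentiating ⟨φξ, φB⟩ = 0 gives ⟨φ∇_u ξ, φb⟩ = ⟨φu,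
φb⟩, and `φ` can be removed because `b` is orthogonal to `ξ`. -/
theorem IsKenmotsu.inner_nabla_xi (hN : IsKenmotsu J φ ξ η)
    (hM : IsProperWarpedProductSemiSlant I₁ I₂ J φ ξ θ f ψ) (p : M₁) (q : M₂)
    (u : TangentSpace (I₁.prod I₂) ((p, q) : M₁ × M₂)) (b : TangentSpace I₂ q) :
    (inner ℝ (covariantDerivAlong J (I₁.prod I₂) ψ (fun z => ξ (ψ z)) (p, q) u)
      (mfderiv (I₁.prod I₂) J ψ (p, q) (inrTangent I₁ I₂ p q b)) : ℝ) =
    inner ℝ (mfderiv (I₁.prod I₂) J ψ (p, q) u)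
      (mfderiv (I₁.prod I₂) J ψ (p, q) (inrTangent I₁ I₂ p q b)) := by
  have hd := mdifferentiableAt_mfderiv_extend J (I₁.prod I₂) hM.smooth (p, q)
  have hξ : MDifferentiableAt (I₁.prod I₂) (J.prod 𝓘(ℝ, F)) (fun z => (TotalSpace.mk' F (ψ z)
      (ξ (ψ z)) : TotalSpace F (fun y : N => TangentSpace J y))) (p, q) :=
    ((hN.smooth_xi (ψ (p, q))).mdifferentiableAt (by simp)).comp (p, q)
      ((hM.smooth (p, q)).mdifferentiableAt (by simp))
  obtain ⟨hd₁, hcov⟩ := hN.nabla_phi_along J _ hξ u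
  obtain ⟨hd₂, -⟩ := hN.nabla_phi_along J _ (hd (inrTangent I₁ I₂ p q b)) u
  have h := mvfderiv_inner_along J _ hd₁ hd₂ u
  have h0 : (fun z : M₁ × M₂ => (inner ℝ (φ (ψ z) (ξ (ψ z)))
      (φ (ψ z) (mfderiv (I₁.prod I₂) J ψ z (FiberBundle.extend (E₁ × E₂)
        (inrTangent I₁ I₂ p q b) z : TangentSpace (I₁.prod I₂) z))) : ℝ)) =ᶠ[𝓝 (p, q)]
      fun _ => 0 := .of_forall fun z => by
    change (inner ℝ (φ (ψ z) (ξ (ψ z))) _ : ℝ) = 0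
    rw [hN.phi_xi, inner_zero_left]
  rw [mvfderiv_congr _ h0, mvfderiv_const, hcov, FiberBundle.extend_apply_self, hN.phi_xi,
    inner_zero_left, hN.eta_xi, one_smul, inner_sub_left, inner_add_left, real_inner_smul_left,
    hN.inner_phi_phi, hN.inner_phi_phi, ← hN.eta_eq, hN.eta_phi, hN.eta_eq _ (mfderiv _ _ _ _ _),
    hM.inner_xi_inr I₁ I₂ J] at h
  have h' : (0 : ℝ) = _ := h
  linarith

/-- `ξ (ln f) = 1` if the second factor has positive dimension. -/
theorem IsProperWarpedProductSemiSlant.inner_gradient_xi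
    (hM : IsProperWarpedProductSemiSlant I₁ I₂ J φ ξ θ f ψ) (hN : IsKenmotsu J φ ξ η)
    (p : M₁) (q : M₂) {b : TangentSpace I₂ q} (hb : b ≠ 0) {c : TangentSpace I₁ p}
    (hc : mfderiv (I₁.prod I₂) J ψ (p, q) (inlTangent I₁ I₂ p q c) = ξ (ψ (p, q))) :
    (inner ℝ (gradient I₁ (fun p => Real.log (f p)) p) c : ℝ) = 1 := by
  have hd := mdifferentiableAt_mfderiv_extend J (I₁.prod I₂) hM.smooth (p, q)
  have hξ : MDifferentiableAt (I₁.prod I₂) (J.prod 𝓘(ℝ, F)) (fun z => (TotalSpace.mk' F (ψ z)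
      (ξ (ψ z)) : TotalSpace F (fun y : N => TangentSpace J y))) (p, q) :=
    ((hN.smooth_xi (ψ (p, q))).mdifferentiableAt (by simp)).comp (p, q)
      ((hM.smooth (p, q)).mdifferentiableAt (by simp))
  -- Differentiate ⟨ξ, B⟩ = 0 along `b`: the first term is f²|b|², the second −ξ(ln f) f²|b|².
  have h := mvfderiv_inner_along J _ hξ (hd (inrTangent I₁ I₂ p q b)) (inrTangent I₁ I₂ p q b)
  have h0 : (fun z : M₁ × M₂ => (inner ℝ (ξ (ψ z))
      (mfderiv (I₁.prod I₂) J ψ z (FiberBundle.extend (E₁ × E₂)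
        (inrTangent I₁ I₂ p q b) z : TangentSpace (I₁.prod I₂) z)) : ℝ)) =ᶠ[𝓝 (p, q)]
      fun _ => 0 := by
    filter_upwards [extend_inrTangent I₁ I₂ p q b] with z hz
    obtain ⟨c', hc'⟩ := hz
    rw [hc']
    exact hM.inner_xi_inr I₁ I₂ J z.1 z.2 c'
  rw [mvfderiv_congr _ h0, mvfderiv_const, FiberBundle.extend_apply_self,
    hN.inner_nabla_xi I₁ I₂ J hM, hM.inner_inr_inr I₁ I₂ J, ← hc] at h
  have h' : (0 : ℝ) = _ + inner ℝ _ (mapHessian J (I₁.prod I₂) ψ (p, q) (inrTangent I₁ I₂ p q b)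
    (inrTangent I₁ I₂ p q b)) := h
  rw [real_inner_comm (mapHessian _ _ _ _ _ _), hM.inner_mapHessian_inr_inr_inl I₁ I₂ J] at h'
  have hpos : f p ^ 2 * (inner ℝ b b : ℝ) ≠ 0 :=
    mul_ne_zero (pow_ne_zero 2 (hM.pos_f p).ne') (inner_self_ne_zero.2 hb)
  refine mul_right_cancel₀ hpos ?_
  linarith

end SemiSlant

/-! ### Traces of bilinear maps -/

section Trace

/-- Both sums are the image of the canonical covariant tensor, which any orthonormal basis
represents. -/
theorem _root_.OrthonormalBasis.sum_bilin_eq {S W : Type*} [NormedAddCommGroup S]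
    [InnerProductSpace ℝ S] [AddCommGroup W] [Module ℝ W] {ι κ : Type*} [Fintype ι] [Fintype κ]
    (a : OrthonormalBasis ι ℝ S) (b : OrthonormalBasis κ ℝ S) (γ : S →ₗ[ℝ] S →ₗ[ℝ] W) :
    ∑ i, γ (a i) (a i) = ∑ k, γ (b k) (b k) := by
  have : FiniteDimensional ℝ S := a.toBasis.finiteDimensional_of_finite
  have h := congrArg (TensorProduct.lift γ)
    ((InnerProductSpace.canonicalCovariantTensor_eq_sum S a).symm.trans
      (InnerProductSpace.canonicalCovariantTensor_eq_sum S b))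
  simpa using h

variable {U V W : Type*} [AddCommGroup U] [Module ℝ U] [NormedAddCommGroup V]
  [InnerProductSpace ℝ V] [AddCommGroup W] [Module ℝ W] {ι κ : Type*} [Fintype ι] [Fintype κ]

/-- An orthonormal frame for the inner product induced by the linear map `ℓ`. -/
structure IsFrame (ℓ : U →ₗ[ℝ] V) (a : ι → U) : Prop where
  orthonormal : Orthonormal ℝ (fun i => ℓ (a i))
  range_le : LinearMap.range ℓ ≤ Submodule.span ℝ (Set.range fun i => ℓ (a i))

/-- The orthonormal basis of the image given by a frame. -/
def IsFrame.basis {ℓ : U →ₗ[ℝ] V} {a : ι → U} (ha : IsFrame ℓ a) :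
    OrthonormalBasis ι ℝ (LinearMap.range ℓ) :=
  OrthonormalBasis.mk (v := fun i => (⟨ℓ (a i), a i, rfl⟩ : LinearMap.range ℓ))
    (by
      classical
      have h := ha.orthonormal
      rw [orthonormal_iff_ite] at h ⊢
      exact h)
    (by
      rintro ⟨v, hv⟩ -
      have h := ha.range_le hv
      have hr : Set.range (fun i => ℓ (a i)) = (LinearMap.range ℓ).subtype ''
          Set.range fun i => (⟨ℓ (a i), a i, rfl⟩ : LinearMap.range ℓ) := by
        rw [← Set.range_comp]
        rfl
      rw [hr, ← Submodule.map_span] at h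
      obtain ⟨s, hs, hsv⟩ := h
      rwa [← show s = ⟨v, hv⟩ from Subtype.ext hsv])

/-- Transport `β` to the image of `ℓ`, where both frames become orthonormal bases. -/
theorem IsFrame.sum_eq {ℓ : U →ₗ[ℝ] V} (hℓ : Function.Injective ℓ) {a : ι → U} {b : κ → U}
    (ha : IsFrame ℓ a) (hb : IsFrame ℓ b) (β : U →ₗ[ℝ] U →ₗ[ℝ] W) :
    ∑ i, β (a i) (a i) = ∑ k, β (b k) (b k) := by
  set e := (LinearEquiv.ofInjective ℓ hℓ).symm
  have he : ∀ u, e ⟨ℓ u, u, rfl⟩ = u := fun u => (LinearEquiv.ofInjective ℓ hℓ).symm_apply_apply u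
  have h := ha.basis.sum_bilin_eq hb.basis (β.compl₁₂ e.toLinearMap e.toLinearMap)
  simpa [IsFrame.basis, he] using h

end Trace

/-! ### Semi-slant warped products at a point -/

section Pointwise

variable {A B U V : Type*} [NormedAddCommGroup A] [InnerProductSpace ℝ A] [FiniteDimensional ℝ A]
  [NormedAddCommGroup B] [InnerProductSpace ℝ B] [FiniteDimensional ℝ B]
  [AddCommGroup U] [Module ℝ U]
  [NormedAddCommGroup V] [InnerProductSpace ℝ V] [FiniteDimensional ℝ V]

/-- The second order data at a point of a semi-slant warped product submanifold of a Kenmotsu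
manifold: the tangent spaces `A`, `B` of the factors and `U` of the product, the differential `ℓ`
and the Hessian `β` of the immersion, the warping factor `c` and the gradient `g` of its
logarithm. -/
structure IsSemiSlantHessian (φ : V →ₗ[ℝ] V) (ξ : V) (θ c : ℝ) (g : A) (i₁ : A →ₗ[ℝ] U)
    (i₂ : B →ₗ[ℝ] U) (ℓ : U →ₗ[ℝ] V) (β : U →ₗ[ℝ] U →ₗ[ℝ] V) : Prop where
  inner_phi_phi : ∀ v w, ⟪φ v, φ w⟫_ℝ = ⟪v, w⟫_ℝ - ⟪ξ, v⟫_ℝ * ⟪ξ, w⟫_ℝ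
  inner_xi_xi : ⟪ξ, ξ⟫_ℝ = 1
  inner_phi_left : ∀ v w, ⟪φ v, w⟫_ℝ = -⟪v, φ w⟫_ℝ
  exists_add : ∀ u, ∃ a b, i₁ a + i₂ b = u
  pos : 0 < c
  inner_inl_inl : ∀ a a', ⟪ℓ (i₁ a), ℓ (i₁ a')⟫_ℝ = ⟪a, a'⟫_ℝ
  inner_inl_inr : ∀ a b, ⟪ℓ (i₁ a), ℓ (i₂ b)⟫_ℝ = 0
  inner_inr_inr : ∀ b b', ⟪ℓ (i₂ b), ℓ (i₂ b')⟫_ℝ = c ^ 2 * ⟪b, b'⟫_ℝ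
  exists_xi_eq : ∃ a, ℓ (i₁ a) = ξ
  exists_phi_eq : ∀ a, ∃ a', ℓ (i₁ a') = φ (ℓ (i₁ a))
  slant : ∀ b, b ≠ 0 → InnerProductGeometry.angle (φ (ℓ (i₂ b)))
    ((LinearMap.range (ℓ ∘ₗ i₂)).starProjection (φ (ℓ (i₂ b)))) = θ
  theta_pos : 0 < θ
  theta_lt : θ < Real.pi / 2
  symm : ∀ u v, β u v = β v u
  inner_inl_inl_inr : ∀ a a' b, ⟪β (i₁ a) (i₁ a'), ℓ (i₂ b)⟫_ℝ = 0
  inner_inl_inr_inr : ∀ a b b', ⟪β (i₁ a) (i₂ b), ℓ (i₂ b')⟫_ℝ = ⟪g, a⟫_ℝ * (c ^ 2 * ⟪b, b'⟫_ℝ)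
  inner_inr_inr_inl : ∀ a b b', ⟪β (i₂ b) (i₂ b'), ℓ (i₁ a)⟫_ℝ = -(⟪g, a⟫_ℝ * (c ^ 2 * ⟪b, b'⟫_ℝ))
  inner_phi_inr : ∀ u a b, ⟪β u (i₁ a), φ (ℓ (i₂ b))⟫_ℝ = ⟪β u (i₂ b), φ (ℓ (i₁ a))⟫_ℝ -
    ⟪ξ, ℓ (i₁ a)⟫_ℝ * ⟪φ (ℓ u), ℓ (i₂ b)⟫_ℝ
  inner_gradient_xi : ∀ b : B, b ≠ 0 → ∀ a, ℓ (i₁ a) = ξ → ⟪g, a⟫_ℝ = 1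

namespace IsSemiSlantHessian

variable {φ : V →ₗ[ℝ] V} {ξ : V} {θ c : ℝ} {g : A} {i₁ : A →ₗ[ℝ] U} {i₂ : B →ₗ[ℝ] U}
  {ℓ : U →ₗ[ℝ] V} {β : U →ₗ[ℝ] U →ₗ[ℝ] V}

theorem injective (h : IsSemiSlantHessian φ ξ θ c g i₁ i₂ ℓ β) : Function.Injective ℓ := by
  refine (injective_iff_map_eq_zero ℓ).2 fun u hu => ?_
  obtain ⟨a, b, rfl⟩ := h.exists_add u
  rw [map_add] at hu
  have ha : a = 0 := by
    have h₀ : ⟪ℓ (i₁ a), ℓ (i₁ a) + ℓ (i₂ b)⟫_ℝ = 0 := by rw [hu, inner_zero_right]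
    rw [inner_add_right, h.inner_inl_inl, h.inner_inl_inr, add_zero] at h₀
    exact inner_self_eq_zero.1 h₀
  have hb : b = 0 := by
    have h₀ : ⟪ℓ (i₁ a) + ℓ (i₂ b), ℓ (i₂ b)⟫_ℝ = 0 := by rw [hu, inner_zero_left]
    rw [inner_add_left, h.inner_inr_inr, h.inner_inl_inr, zero_add] at h₀
    exact inner_self_eq_zero.1 ((mul_eq_zero.1 h₀).resolve_left (pow_ne_zero 2 h.pos.ne'))
  simp [ha, hb]

/-- The tangential part of `φ` on the slant factor. -/
def tangentialPart (φ : V →ₗ[ℝ] V) (i₂ : B →ₗ[ℝ] U) (ℓ : U →ₗ[ℝ] V) : B →ₗ[ℝ] V :=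
  (LinearMap.range (ℓ ∘ₗ i₂)).starProjection.toLinearMap ∘ₗ φ ∘ₗ ℓ ∘ₗ i₂

/-- The normal part of `φ` on the slant factor. -/
def normalPart (φ : V →ₗ[ℝ] V) (i₂ : B →ₗ[ℝ] U) (ℓ : U →ₗ[ℝ] V) : B →ₗ[ℝ] V :=
  φ ∘ₗ ℓ ∘ₗ i₂ - tangentialPart φ i₂ ℓ

omit [FiniteDimensional ℝ A] in
theorem exists_tangentialPart (φ : V →ₗ[ℝ] V) (i₂ : B →ₗ[ℝ] U) (ℓ : U →ₗ[ℝ] V) (b : B) :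
    ∃ t, ℓ (i₂ t) = tangentialPart φ i₂ ℓ b :=
  Submodule.starProjection_apply_mem (LinearMap.range (ℓ ∘ₗ i₂)) (φ (ℓ (i₂ b)))

theorem inner_normalPart_inr (φ : V →ₗ[ℝ] V) (i₂ : B →ₗ[ℝ] U) (ℓ : U →ₗ[ℝ] V) (b b' : B) :
    ⟪normalPart φ i₂ ℓ b, ℓ (i₂ b')⟫_ℝ = 0 :=
  Submodule.starProjection_inner_eq_zero (K := LinearMap.range (ℓ ∘ₗ i₂)) (φ (ℓ (i₂ b)))
    (ℓ (i₂ b')) ⟨b', rfl⟩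

theorem inner_tangentialPart_inr (φ : V →ₗ[ℝ] V) (i₂ : B →ₗ[ℝ] U) (ℓ : U →ₗ[ℝ] V) (b b' : B) :
    ⟪tangentialPart φ i₂ ℓ b, ℓ (i₂ b')⟫_ℝ = ⟪φ (ℓ (i₂ b)), ℓ (i₂ b')⟫_ℝ := by
  have h := inner_normalPart_inr φ i₂ ℓ b b'
  rw [normalPart, LinearMap.sub_apply, inner_sub_left] at h
  exact (sub_eq_zero.1 h).symm

variable (h : IsSemiSlantHessian φ ξ θ c g i₁ i₂ ℓ β)
include h

theorem inner_xi_inr (b : B) : ⟪ξ, ℓ (i₂ b)⟫_ℝ = 0 := by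
  obtain ⟨a, ha⟩ := h.exists_xi_eq
  rw [← ha, h.inner_inl_inr]

theorem norm_phi_inr (b : B) : ‖φ (ℓ (i₂ b))‖ = ‖ℓ (i₂ b)‖ := by
  rw [← sq_eq_sq₀ (norm_nonneg _) (norm_nonneg _), ← real_inner_self_eq_norm_sq,
    ← real_inner_self_eq_norm_sq, h.inner_phi_phi, h.inner_xi_inr]
  ring

/-- An orthogonal projection P satisfies ⟨v, Pv⟩ = ‖Pv‖², so cos θ = ‖Pv‖ / ‖v‖; here v = φ(b) is as
long as `b`. -/
theorem norm_tangentialPart (b : B) :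
    ‖tangentialPart φ i₂ ℓ b‖ = Real.cos θ * ‖ℓ (i₂ b)‖ := by
  rcases eq_or_ne b 0 with rfl | hb
  · simp
  have hs := h.slant b hb
  have hT : (LinearMap.range (ℓ ∘ₗ i₂)).starProjection (φ (ℓ (i₂ b))) =
    tangentialPart φ i₂ ℓ b := rfl
  rw [hT] at hs
  -- The angle with the zero vector is π/2 by convention, which θ < π/2 excludes.
  have h0 : tangentialPart φ i₂ ℓ b ≠ 0 := by
    intro h0
    rw [h0, InnerProductGeometry.angle_zero_right] at hs
    exact h.theta_lt.ne hs.symm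
  obtain ⟨t, ht⟩ := exists_tangentialPart φ i₂ ℓ b
  have hi := InnerProductGeometry.cos_angle_mul_norm_mul_norm (φ (ℓ (i₂ b)))
    (tangentialPart φ i₂ ℓ b)
  have hi' : ⟪φ (ℓ (i₂ b)), tangentialPart φ i₂ ℓ b⟫_ℝ =
      ‖tangentialPart φ i₂ ℓ b‖ * ‖tangentialPart φ i₂ ℓ b‖ := by
    rw [← real_inner_self_eq_norm_mul_norm, ← ht, ← inner_tangentialPart_inr, ht]
  rw [hs, hi', h.norm_phi_inr, ← mul_assoc] at hi
  exact (mul_right_cancel₀ (norm_ne_zero_iff.2 h0) hi).symm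

/-- Polarization of `norm_tangentialPart`. -/
theorem inner_tangentialPart_tangentialPart (b b' : B) :
    ⟪tangentialPart φ i₂ ℓ b, tangentialPart φ i₂ ℓ b'⟫_ℝ =
      Real.cos θ ^ 2 * ⟪ℓ (i₂ b), ℓ (i₂ b')⟫_ℝ := by
  have h₁ := congrArg (· ^ 2) (h.norm_tangentialPart (b + b'))
  have h₂ := congrArg (· ^ 2) (h.norm_tangentialPart b)
  have h₃ := congrArg (· ^ 2) (h.norm_tangentialPart b')
  simp only [map_add, mul_pow, norm_add_sq_real] at h₁ h₂ h₃
  linarith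

/-- Pythagoras: `φ` preserves inner products on M_θ, and the tangential part takes the share cos²θ.
-/
theorem inner_normalPart_normalPart (b b' : B) :
    ⟪normalPart φ i₂ ℓ b, normalPart φ i₂ ℓ b'⟫_ℝ =
      Real.sin θ ^ 2 * ⟪ℓ (i₂ b), ℓ (i₂ b')⟫_ℝ := by
  obtain ⟨t, ht⟩ := exists_tangentialPart φ i₂ ℓ b'
  obtain ⟨t', ht'⟩ := exists_tangentialPart φ i₂ ℓ b
  have h₁ : ⟪φ (ℓ (i₂ b)), φ (ℓ (i₂ b'))⟫_ℝ = ⟪ℓ (i₂ b), ℓ (i₂ b')⟫_ℝ := by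
    rw [h.inner_phi_phi, h.inner_xi_inr, zero_mul, sub_zero]
  have h₂ : ⟪tangentialPart φ i₂ ℓ b, φ (ℓ (i₂ b'))⟫_ℝ =
      ⟪tangentialPart φ i₂ ℓ b, tangentialPart φ i₂ ℓ b'⟫_ℝ := by
    rw [← ht', real_inner_comm, ← inner_tangentialPart_inr, real_inner_comm]
  have h₃ : ⟪normalPart φ i₂ ℓ b, tangentialPart φ i₂ ℓ b'⟫_ℝ = 0 := by
    rw [← ht, inner_normalPart_inr]
  rw [show normalPart φ i₂ ℓ b' = φ (ℓ (i₂ b')) - tangentialPart φ i₂ ℓ b' from rfl,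
    inner_sub_right, h₃, sub_zero, show normalPart φ i₂ ℓ b = φ (ℓ (i₂ b)) -
      tangentialPart φ i₂ ℓ b from rfl, inner_sub_left, h₁, h₂,
    h.inner_tangentialPart_tangentialPart, Real.sin_sq]
  ring

/-- `φ` is skew and preserves M_T, so φ(M_θ) is orthogonal to M_T. -/
theorem inner_normalPart_inl (b : B) (a : A) : ⟪normalPart φ i₂ ℓ b, ℓ (i₁ a)⟫_ℝ = 0 := by
  obtain ⟨t, ht⟩ := exists_tangentialPart φ i₂ ℓ b
  obtain ⟨a', ha'⟩ := h.exists_phi_eq a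
  rw [show normalPart φ i₂ ℓ b = φ (ℓ (i₂ b)) - tangentialPart φ i₂ ℓ b from rfl, inner_sub_left,
    h.inner_phi_left, ← ha', ← ht, real_inner_comm, h.inner_inl_inr, real_inner_comm,
    h.inner_inl_inr]
  simp

theorem normalPart_mem (b : B) : normalPart φ i₂ ℓ b ∈ (LinearMap.range ℓ)ᗮ := by
  rw [Submodule.mem_orthogonal']
  rintro _ ⟨u, rfl⟩
  obtain ⟨a, b', rfl⟩ := h.exists_add u
  rw [map_add, inner_add_right, h.inner_normalPart_inl, inner_normalPart_inr, add_zero]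

/-- The key identity. Subtract from the pairing with φ(b') the pairing with its tangential part; the
latter is known from ∇_X Z = X(ln f) Z. -/
theorem inner_hessian_normalPart (a : A) (b b' : B) :
    ⟪β (i₁ a) (i₂ b), normalPart φ i₂ ℓ b'⟫_ℝ =
      (⟪g, a⟫_ℝ - ⟪ξ, ℓ (i₁ a)⟫_ℝ) * ⟪φ (ℓ (i₂ b)), ℓ (i₂ b')⟫_ℝ -
        ⟪ℓ (i₁ g), φ (ℓ (i₁ a))⟫_ℝ * ⟪ℓ (i₂ b), ℓ (i₂ b')⟫_ℝ := by
  obtain ⟨t, ht⟩ := exists_tangentialPart φ i₂ ℓ b'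
  obtain ⟨a', ha'⟩ := h.exists_phi_eq a
  have h₁ : ⟪β (i₁ a) (i₂ b), tangentialPart φ i₂ ℓ b'⟫_ℝ =
      -(⟪g, a⟫_ℝ * ⟪φ (ℓ (i₂ b)), ℓ (i₂ b')⟫_ℝ) := by
    rw [← ht, h.inner_inl_inr_inr, ← h.inner_inr_inr, ht,
      real_inner_comm (tangentialPart φ i₂ ℓ b'), inner_tangentialPart_inr, h.inner_phi_left,
      real_inner_comm (φ (ℓ (i₂ b)))]
    ring
  have h₂ : ⟪β (i₁ a) (i₂ b), φ (ℓ (i₂ b'))⟫_ℝ =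
      -(⟪ℓ (i₁ g), φ (ℓ (i₁ a))⟫_ℝ * ⟪ℓ (i₂ b), ℓ (i₂ b')⟫_ℝ) -
        ⟪ξ, ℓ (i₁ a)⟫_ℝ * ⟪φ (ℓ (i₂ b)), ℓ (i₂ b')⟫_ℝ := by
    -- Symmetry first, so as to differentiate in the direction `b`: the Hessian that remains has
    -- both arguments in M_θ and is paired with φ(a), a vector of M_T.
    rw [h.symm, h.inner_phi_inr, ← ha', h.inner_inr_inr_inl, h.inner_inl_inl, h.inner_inr_inr]
  rw [show normalPart φ i₂ ℓ b' = φ (ℓ (i₂ b')) - tangentialPart φ i₂ ℓ b' from rfl,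
    inner_sub_right, h₁, h₂]
  ring

theorem sin_pos : 0 < Real.sin θ :=
  Real.sin_pos_of_pos_of_lt_pi h.theta_pos (by linarith [h.theta_lt, Real.pi_pos])

theorem inner_starProjection_normalPart (v : V) (b : B) :
    ⟪(LinearMap.range ℓ)ᗮ.starProjection v, normalPart φ i₂ ℓ b⟫_ℝ =
      ⟪v, normalPart φ i₂ ℓ b⟫_ℝ := by
  rw [Submodule.inner_starProjection_left_eq_right,
    Submodule.starProjection_eq_self_iff.2 (h.normalPart_mem b)]

/-- The frame of the slant factor obtained by rescaling an orthonormal basis. -/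
theorem inner_scaled {κ : Type*} [Fintype κ] [DecidableEq κ] (w : OrthonormalBasis κ ℝ B)
    (k k' : κ) : ⟪ℓ (i₂ (c⁻¹ • w k)), ℓ (i₂ (c⁻¹ • w k'))⟫_ℝ = if k = k' then 1 else 0 := by
  have hw := orthonormal_iff_ite.1 w.orthonormal k k'
  rw [h.inner_inr_inr, real_inner_smul_left, real_inner_smul_right, hw]
  have := h.pos.ne'
  field_simp

/-- Parseval; the factor `c⁻¹` compensates the warping `c ^ 2` of the metric. -/
theorem sum_inner_sq {κ : Type*} [Fintype κ] (w : OrthonormalBasis κ ℝ B) (t : B) :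
    ∑ k, ⟪ℓ (i₂ t), ℓ (i₂ (c⁻¹ • w k))⟫_ℝ ^ 2 = ‖ℓ (i₂ t)‖ ^ 2 := by
  rw [← real_inner_self_eq_norm_sq, h.inner_inr_inr, real_inner_self_eq_norm_sq,
    ← w.sum_sq_inner_left, Finset.mul_sum]
  refine Finset.sum_congr rfl fun k _ => ?_
  rw [h.inner_inr_inr, real_inner_smul_right]
  have := h.pos.ne'
  field_simp

/-- The contribution of `h(a, b)`, for `b` in an orthonormal frame of the slant factor. -/
theorem le_norm_sq_mixed {κ : Type*} [Fintype κ] (w : OrthonormalBasis κ ℝ B) (a : A) (k : κ) :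
    Real.cos θ ^ 2 * (⟪g, a⟫_ℝ - ⟪ξ, ℓ (i₁ a)⟫_ℝ) ^ 2 + ⟪ℓ (i₁ g), φ (ℓ (i₁ a))⟫_ℝ ^ 2 ≤
      Real.sin θ ^ 2 *
        ‖(LinearMap.range ℓ)ᗮ.starProjection (β (i₁ a) (i₂ (c⁻¹ • w k)))‖ ^ 2 := by
  classical
  set x := (LinearMap.range ℓ)ᗮ.starProjection (β (i₁ a) (i₂ (c⁻¹ • w k))) with hx
  have hs := h.sin_pos
  have ho : Orthonormal ℝ fun k' => (Real.sin θ)⁻¹ • normalPart φ i₂ ℓ (c⁻¹ • w k') := by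
    rw [orthonormal_iff_ite]
    intro k₁ k₂
    rw [real_inner_smul_left, real_inner_smul_right, h.inner_normalPart_normalPart, h.inner_scaled]
    field_simp
  -- Bessel for the orthonormal normals csc θ · F e_k'; other normal directions are discarded.
  have hB := ho.sum_inner_products_le x (s := Finset.univ)
  set μ := ⟪g, a⟫_ℝ - ⟪ξ, ℓ (i₁ a)⟫_ℝ
  set ν := ⟪ℓ (i₁ g), φ (ℓ (i₁ a))⟫_ℝ
  set τ : κ → ℝ := fun k' => ⟪φ (ℓ (i₂ (c⁻¹ • w k))), ℓ (i₂ (c⁻¹ • w k'))⟫_ℝ with hτ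
  have hterm : ∀ k', ‖⟪(Real.sin θ)⁻¹ • normalPart φ i₂ ℓ (c⁻¹ • w k'), x⟫_ℝ‖ ^ 2 =
      (Real.sin θ ^ 2)⁻¹ * (μ ^ 2 * τ k' ^ 2 +
        if k = k' then ν ^ 2 - 2 * μ * ν * τ k' else 0) := by
    intro k'
    rw [Real.norm_eq_abs, sq_abs, real_inner_smul_left, real_inner_comm, hx,
      h.inner_starProjection_normalPart, h.inner_hessian_normalPart, h.inner_scaled]
    change ((Real.sin θ)⁻¹ * (μ * τ k' - ν * _)) ^ 2 = _
    split_ifs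
    · field_simp
      ring
    · field_simp
      ring
  -- Skewness of `φ` removes the cross term in μν.
  have hτk : τ k = 0 := by
    have := h.inner_phi_left (ℓ (i₂ (c⁻¹ • w k))) (ℓ (i₂ (c⁻¹ • w k)))
    rw [real_inner_comm] at this
    simp only [hτ]
    rw [real_inner_comm]
    linarith
  -- By Parseval the sum is the squared length of the tangential part of φ(e_k), a unit vector.
  have hτs : ∑ k', τ k' ^ 2 = Real.cos θ ^ 2 := by
    obtain ⟨t, ht⟩ := exists_tangentialPart φ i₂ ℓ (c⁻¹ • w k)
    have h₁ : ∀ k', τ k' = ⟪ℓ (i₂ t), ℓ (i₂ (c⁻¹ • w k'))⟫_ℝ := fun k' => by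
      rw [ht, inner_tangentialPart_inr]
    simp only [h₁]
    rw [h.sum_inner_sq, ← real_inner_self_eq_norm_sq, ht, h.inner_tangentialPart_tangentialPart,
      h.inner_scaled, if_pos rfl, mul_one]
  simp only [hterm] at hB
  rw [← Finset.mul_sum, Finset.sum_add_distrib, ← Finset.mul_sum, hτs, Finset.sum_ite_eq,
    if_pos (Finset.mem_univ k), hτk, inv_mul_le_iff₀ (pow_pos hs 2)] at hB
  linarith

/-- Parseval for ∇ ln f − ξ, with ξ(ln f) = 1 and |ξ| = 1. A nonzero `b` is what provides ξ(ln f) =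
1. -/
theorem sum_gradient_sub_xi_sq {ι : Type*} [Fintype ι] (x : OrthonormalBasis ι ℝ A) {b : B}
    (hb : b ≠ 0) : ∑ i, (⟪g, x i⟫_ℝ - ⟪ξ, ℓ (i₁ (x i))⟫_ℝ) ^ 2 = ‖g‖ ^ 2 - 1 := by
  obtain ⟨a, ha⟩ := h.exists_xi_eq
  have h₁ : ∀ i, ⟪g, x i⟫_ℝ - ⟪ξ, ℓ (i₁ (x i))⟫_ℝ = ⟪g - a, x i⟫_ℝ := fun i => by
    rw [← ha, h.inner_inl_inl, inner_sub_left]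
  have h₂ := h.inner_xi_xi
  rw [← ha, h.inner_inl_inl, real_inner_self_eq_norm_sq] at h₂
  simp only [h₁]
  rw [x.sum_sq_inner_left, norm_sub_sq_real, h.inner_gradient_xi b hb a ha, h₂]
  ring

/-- Parseval for φ(∇ ln f), which lies in M_T by invariance and has squared norm ‖∇ ln f‖² − (ξ ln
f)². -/
theorem sum_gradient_phi_sq {ι : Type*} [Fintype ι] (x : OrthonormalBasis ι ℝ A) {b : B}
    (hb : b ≠ 0) : ∑ i, ⟪ℓ (i₁ g), φ (ℓ (i₁ (x i)))⟫_ℝ ^ 2 = ‖g‖ ^ 2 - 1 := by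
  obtain ⟨a, ha⟩ := h.exists_xi_eq
  obtain ⟨g', hg'⟩ := h.exists_phi_eq g
  have h₁ : ∀ i, ⟪ℓ (i₁ g), φ (ℓ (i₁ (x i)))⟫_ℝ ^ 2 = ⟪g', x i⟫_ℝ ^ 2 := fun i => by
    rw [← h.inner_inl_inl, hg', h.inner_phi_left, neg_sq]
  simp only [h₁]
  rw [x.sum_sq_inner_left, ← real_inner_self_eq_norm_sq, ← h.inner_inl_inl, hg', h.inner_phi_phi,
    h.inner_inl_inl, real_inner_self_eq_norm_sq, ← ha, h.inner_inl_inl, real_inner_comm,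
    h.inner_gradient_xi b hb a ha]
  ring

theorem le_sum_mixed {ι κ : Type*} [Fintype ι] [Fintype κ] (x : OrthonormalBasis ι ℝ A)
    (w : OrthonormalBasis κ ℝ B) :
    Fintype.card κ * ((Real.sin θ)⁻¹ ^ 2 + Real.cot θ ^ 2) * (‖g‖ ^ 2 - 1) ≤
      ∑ i, ∑ k, ‖(LinearMap.range ℓ)ᗮ.starProjection (β (i₁ (x i)) (i₂ (c⁻¹ • w k)))‖ ^ 2 := by
  -- Without slant directions ξ(ln f) = 1 is not available, but both sides are zero.
  rcases isEmpty_or_nonempty κ with hκ | ⟨⟨k₀⟩⟩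
  · simp
  have hb : w k₀ ≠ 0 := w.orthonormal.ne_zero k₀
  have hs := h.sin_pos
  have hle := Finset.sum_le_sum fun i (_ : i ∈ Finset.univ) =>
    Finset.sum_le_sum fun k (_ : k ∈ Finset.univ) => h.le_norm_sq_mixed w (x i) k
  simp only [Finset.sum_const, ← Finset.mul_sum, nsmul_eq_mul, Finset.sum_add_distrib,
    Finset.card_univ] at hle
  rw [h.sum_gradient_sub_xi_sq x hb, h.sum_gradient_phi_sq x hb] at hle
  rw [Real.cot_eq_cos_div_sin, ← mul_le_mul_iff_right₀ (pow_pos hs 2)]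
  refine le_trans (le_of_eq ?_) hle
  field_simp
  ring

/-- The frame adapted to the product structure. -/
theorem isFrame {ι κ : Type*} [Fintype ι] [Fintype κ] (x : OrthonormalBasis ι ℝ A)
    (w : OrthonormalBasis κ ℝ B) :
    IsFrame ℓ (Sum.elim (fun i => i₁ (x i)) fun k => i₂ (c⁻¹ • w k)) where
  orthonormal := by
    classical
    rw [orthonormal_iff_ite]
    rintro (i | k) (i' | k')
    · simp [h.inner_inl_inl, orthonormal_iff_ite.1 x.orthonormal]
    · simp only [Sum.elim_inl, Sum.elim_inr, h.inner_inl_inr, reduceCtorEq, if_false]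
    · simp only [Sum.elim_inl, Sum.elim_inr, real_inner_comm (ℓ (i₁ _)), h.inner_inl_inr,
        reduceCtorEq, if_false]
    · simp only [Sum.elim_inr, h.inner_scaled, Sum.inr.injEq]
  range_le := by
    rintro _ ⟨u, rfl⟩
    obtain ⟨a, b, rfl⟩ := h.exists_add u
    have hc := h.pos.ne'
    rw [map_add]
    refine Submodule.add_mem _ ?_ ?_
    · rw [← x.sum_repr' a, map_sum, map_sum]
      refine Submodule.sum_mem _ fun i _ => ?_
      rw [map_smul, map_smul]
      exact Submodule.smul_mem _ _ (Submodule.subset_span ⟨Sum.inl i, rfl⟩)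
    · rw [← w.sum_repr' b, map_sum, map_sum]
      refine Submodule.sum_mem _ fun k _ => ?_
      have hk : ⟪w k, b⟫_ℝ • w k = (⟪w k, b⟫_ℝ * c) • c⁻¹ • w k := by
        rw [smul_smul, mul_assoc, mul_inv_cancel₀ hc, mul_one]
      rw [hk, map_smul, map_smul]
      exact Submodule.smul_mem _ _ (Submodule.subset_span ⟨Sum.inr k, rfl⟩)

/-- The second fundamental form as a bilinear map. -/
def sff (ℓ : U →ₗ[ℝ] V) (β : U →ₗ[ℝ] U →ₗ[ℝ] V) : U →ₗ[ℝ] U →ₗ[ℝ] V :=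
  β.compr₂ (LinearMap.range ℓ)ᗮ.starProjection.toLinearMap

-- Change the frame in one argument at a time; each change is invariance of a trace.
omit h in
theorem sum_norm_sq_eq (hℓ : Function.Injective ℓ) {ι κ : Type*} [Fintype ι] [Fintype κ]
    {a : ι → U} {b : κ → U} (ha : IsFrame ℓ a) (hb : IsFrame ℓ b) (γ : U →ₗ[ℝ] U →ₗ[ℝ] V) :
    ∑ i, ∑ j, ‖γ (a i) (a j)‖ ^ 2 = ∑ i, ∑ j, ‖γ (b i) (b j)‖ ^ 2 := by
  have h₁ : ∀ u, ∑ j, ‖γ u (a j)‖ ^ 2 = ∑ j, ‖γ u (b j)‖ ^ 2 := fun u => by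
    have := ha.sum_eq hℓ hb ((innerₗ V).compl₁₂ (γ u) (γ u))
    simpa only [LinearMap.compl₁₂_apply, innerₗ_apply_apply, real_inner_self_eq_norm_sq] using this
  have h₂ : ∀ v, ∑ i, ‖γ (a i) v‖ ^ 2 = ∑ i, ‖γ (b i) v‖ ^ 2 := fun v => by
    have := ha.sum_eq hℓ hb ((innerₗ V).compl₁₂ (γ.flip v) (γ.flip v))
    simpa only [LinearMap.compl₁₂_apply, innerₗ_apply_apply, real_inner_self_eq_norm_sq,
      LinearMap.flip_apply] using this
  simp only [h₁]
  rw [Finset.sum_comm]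
  simp only [h₂]
  rw [Finset.sum_comm]

/-- The squared norm of the second fundamental form, split along the product structure. -/
theorem sum_norm_sq_sff {ι κ υ : Type*} [Fintype ι] [Fintype κ] [Fintype υ]
    (x : OrthonormalBasis ι ℝ A) (w : OrthonormalBasis κ ℝ B) {e : υ → U} (he : IsFrame ℓ e) :
    ∑ i, ∑ j, ‖sff ℓ β (e i) (e j)‖ ^ 2 =
      ∑ i, ∑ j, ‖sff ℓ β (i₁ (x i)) (i₁ (x j))‖ ^ 2 +
        2 * ∑ i, ∑ k, ‖sff ℓ β (i₁ (x i)) (i₂ (c⁻¹ • w k))‖ ^ 2 +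
        ∑ k, ∑ l, ‖sff ℓ β (i₂ (c⁻¹ • w k)) (i₂ (c⁻¹ • w l))‖ ^ 2 := by
  rw [sum_norm_sq_eq h.injective he (h.isFrame x w)]
  simp only [Fintype.sum_sum_type, Sum.elim_inl, Sum.elim_inr, Finset.sum_add_distrib]
  have hs : ∑ k, ∑ i, ‖sff ℓ β (i₂ (c⁻¹ • w k)) (i₁ (x i))‖ ^ 2 =
      ∑ i, ∑ k, ‖sff ℓ β (i₁ (x i)) (i₂ (c⁻¹ • w k))‖ ^ 2 := by
    rw [Finset.sum_comm]
    refine Finset.sum_congr rfl fun i _ => Finset.sum_congr rfl fun k _ => ?_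
    rw [sff, LinearMap.compr₂_apply, LinearMap.compr₂_apply, h.symm]
  rw [hs]
  ring

/-- The pure blocks are dropped; the factor 2 counts the mixed block twice, by symmetry of h. -/
theorem le_sum_norm_sq_sff {υ : Type*} [Fintype υ] {e : υ → U} (he : IsFrame ℓ e) :
    2 * Module.finrank ℝ B * ((Real.sin θ)⁻¹ ^ 2 + Real.cot θ ^ 2) * (‖g‖ ^ 2 - 1) ≤
      ∑ i, ∑ j, ‖sff ℓ β (e i) (e j)‖ ^ 2 := by
  have h₁ := h.le_sum_mixed (stdOrthonormalBasis ℝ A) (stdOrthonormalBasis ℝ B)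
  rw [Fintype.card_fin] at h₁
  rw [h.sum_norm_sq_sff (stdOrthonormalBasis ℝ A) (stdOrthonormalBasis ℝ B) he]
  have h₂ : 0 ≤ ∑ i, ∑ j, ‖sff ℓ β (i₁ (stdOrthonormalBasis ℝ A i))
    (i₁ (stdOrthonormalBasis ℝ A j))‖ ^ 2 := by positivity
  have h₃ : 0 ≤ ∑ k, ∑ l, ‖sff ℓ β (i₂ (c⁻¹ • stdOrthonormalBasis ℝ B k))
    (i₂ (c⁻¹ • stdOrthonormalBasis ℝ B l))‖ ^ 2 := by positivity
  change _ ≤ ∑ i, ∑ k, ‖sff ℓ β (i₁ (stdOrthonormalBasis ℝ A i))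
    (i₂ (c⁻¹ • stdOrthonormalBasis ℝ B k))‖ ^ 2 at h₁
  linarith

omit h in
theorem _root_.OrthonormalBasis.bilin_eq_zero {S W : Type*} [NormedAddCommGroup S]
    [InnerProductSpace ℝ S] [NormedAddCommGroup W] [Module ℝ W] {ι : Type*} [Fintype ι]
    (x : OrthonormalBasis ι ℝ S) (γ : S →ₗ[ℝ] S →ₗ[ℝ] W)
    (hγ : ∑ i, ∑ j, ‖γ (x i) (x j)‖ ^ 2 = 0) : γ = 0 := by
  refine x.toBasis.ext fun i => x.toBasis.ext fun j => ?_
  rw [Finset.sum_eq_zero_iff_of_nonneg fun i _ => by positivity] at hγ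
  have hi := hγ i (Finset.mem_univ i)
  rw [Finset.sum_eq_zero_iff_of_nonneg fun i _ => by positivity] at hi
  simpa using hi j (Finset.mem_univ j)

/-! ### The equality case at a point -/

section Equality

variable {υ : Type*} [Fintype υ] {e : υ → U} (he : IsFrame ℓ e)
  (heq : ∑ i, ∑ j, ‖sff ℓ β (e i) (e j)‖ ^ 2 =
    2 * Module.finrank ℝ B * ((Real.sin θ)⁻¹ ^ 2 + Real.cot θ ^ 2) * (‖g‖ ^ 2 - 1))
include he heq

/-- The mixed block alone already reaches the bound, so the two nonnegative pure blocks must vanish.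
-/
theorem sff_eq_zero_of_eq : (∀ a a', sff ℓ β (i₁ a) (i₁ a') = 0) ∧
    ∀ b b', sff ℓ β (i₂ b) (i₂ b') = 0 := by
  have h₁ := h.le_sum_mixed (stdOrthonormalBasis ℝ A) (stdOrthonormalBasis ℝ B)
  rw [Fintype.card_fin] at h₁
  rw [h.sum_norm_sq_sff (stdOrthonormalBasis ℝ A) (stdOrthonormalBasis ℝ B) he] at heq
  have h₂ : 0 ≤ ∑ i, ∑ j, ‖sff ℓ β (i₁ (stdOrthonormalBasis ℝ A i))
    (i₁ (stdOrthonormalBasis ℝ A j))‖ ^ 2 := by positivity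
  have h₃ : 0 ≤ ∑ k, ∑ l, ‖sff ℓ β (i₂ (c⁻¹ • stdOrthonormalBasis ℝ B k))
    (i₂ (c⁻¹ • stdOrthonormalBasis ℝ B l))‖ ^ 2 := by positivity
  change _ ≤ ∑ i, ∑ k, ‖sff ℓ β (i₁ (stdOrthonormalBasis ℝ A i))
    (i₂ (c⁻¹ • stdOrthonormalBasis ℝ B k))‖ ^ 2 at h₁
  have hA := (stdOrthonormalBasis ℝ A).bilin_eq_zero ((sff ℓ β).compl₁₂ i₁ i₁)
    (by simp only [LinearMap.compl₁₂_apply]; linarith)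
  have hB := (stdOrthonormalBasis ℝ B).bilin_eq_zero
    ((sff ℓ β).compl₁₂ (c⁻¹ • i₂) (c⁻¹ • i₂))
    (by simp only [LinearMap.compl₁₂_apply, LinearMap.smul_apply, ← map_smul]; linarith)
  refine ⟨fun a a' => congrArg (fun γ : A →ₗ[ℝ] A →ₗ[ℝ] V => γ a a') hA, fun b b' => ?_⟩
  have hc := h.pos.ne'
  -- Evaluation at multiples by `c` undoes the rescaling of the frame.
  have := congrArg (fun γ : B →ₗ[ℝ] B →ₗ[ℝ] V => γ (c • b) (c • b')) hB
  simpa [smul_smul, hc] using this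

theorem trace_sff_eq_zero : ∑ i, sff ℓ β (e i) (e i) = 0 := by
  obtain ⟨hA, hB⟩ := h.sff_eq_zero_of_eq he heq
  rw [he.sum_eq h.injective (h.isFrame (stdOrthonormalBasis ℝ A) (stdOrthonormalBasis ℝ B))]
  simp [Fintype.sum_sum_type, hA, hB]

/-- Vanishing of h makes ∇_X Y tangent to M, and its M_θ component is zero by the Koszul formula. -/
theorem hessian_inl_mem (a a' : A) : β (i₁ a) (i₁ a') ∈ LinearMap.range (ℓ ∘ₗ i₁) := by
  have h₀ : β (i₁ a) (i₁ a') ∈ LinearMap.range ℓ :=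
    (LinearMap.range ℓ).orthogonal_orthogonal ▸
      (Submodule.starProjection_apply_eq_zero_iff _).1 ((h.sff_eq_zero_of_eq he heq).1 a a')
  obtain ⟨u, hu⟩ := h₀
  obtain ⟨d, b, rfl⟩ := h.exists_add u
  have h₁ := h.inner_inl_inl_inr a a' b
  rw [← hu, map_add, inner_add_left, h.inner_inl_inr, zero_add, h.inner_inr_inr, mul_eq_zero,
    or_iff_right (pow_ne_zero 2 h.pos.ne'), inner_self_eq_zero] at h₁
  exact ⟨d, by rw [← hu, h₁, map_zero, add_zero]; rfl⟩

/-- ∇_Z W is tangent to M; projecting off M_θ leaves its M_T component, which the Koszul formula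
identifies. -/
theorem starProjection_hessian_inr (b b' : B) :
    (LinearMap.range (ℓ ∘ₗ i₂))ᗮ.starProjection (β (i₂ b) (i₂ b')) =
      ⟪ℓ (i₂ b), ℓ (i₂ b')⟫_ℝ • -ℓ (i₁ g) := by
  have h₀ : β (i₂ b) (i₂ b') ∈ LinearMap.range ℓ :=
    (LinearMap.range ℓ).orthogonal_orthogonal ▸
      (Submodule.starProjection_apply_eq_zero_iff _).1 ((h.sff_eq_zero_of_eq he heq).2 b b')
  obtain ⟨u, hu⟩ := h₀
  obtain ⟨d, b'', rfl⟩ := h.exists_add u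
  have hd : d = -(⟪ℓ (i₂ b), ℓ (i₂ b')⟫_ℝ • g) := by
    refine ext_inner_right ℝ fun a => ?_
    have h₁ := h.inner_inr_inr_inl a b b'
    rw [← hu, map_add, inner_add_left, h.inner_inl_inl, real_inner_comm (ℓ (i₁ a)),
      h.inner_inl_inr, add_zero, ← h.inner_inr_inr] at h₁
    rw [h₁, inner_neg_left, real_inner_smul_left]
    ring
  have hdm : ℓ (i₁ d) ∈ (LinearMap.range (ℓ ∘ₗ i₂))ᗮ := by
    rw [Submodule.mem_orthogonal']
    rintro _ ⟨t, rfl⟩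
    exact h.inner_inl_inr d t
  have hbm : ℓ (i₂ b'') ∈ (LinearMap.range (ℓ ∘ₗ i₂))ᗮᗮ := by
    rw [Submodule.orthogonal_orthogonal]
    exact ⟨b'', rfl⟩
  rw [← hu, map_add, map_add, Submodule.starProjection_eq_self_iff.2 hdm,
    (Submodule.starProjection_apply_eq_zero_iff _).2 hbm, add_zero, hd, map_neg, map_neg, map_smul,
    map_smul, smul_neg]

end Equality

end IsSemiSlantHessian

end Pointwise

/-! ### Orthonormal frames of submanifolds -/

section Frame

variable {F : Type*} [NormedAddCommGroup F] [NormedSpace ℝ F] [FiniteDimensional ℝ F]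
  {H : Type*} [TopologicalSpace H] (J : ModelWithCorners ℝ F H)
  {N : Type*} [TopologicalSpace N] [ChartedSpace H N]
  [RiemannianBundle (fun y : N => TangentSpace J y)]
  {E : Type*} [NormedAddCommGroup E] [NormedSpace ℝ E]
  {H' : Type*} [TopologicalSpace H'] (I : ModelWithCorners ℝ E H')
  {M : Type*} [TopologicalSpace M] [ChartedSpace H' M]

theorem mfderiv_orthonormalFrame (ψ : M → N) (x : M)
    (i : Fin (Module.finrank ℝ (tangentImage J I ψ x))) :
    mfderiv I J ψ x (orthonormalFrame J I ψ x i) =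
      stdOrthonormalBasis ℝ (tangentImage J I ψ x) i :=
  (LinearMap.mem_range.1 (stdOrthonormalBasis ℝ (tangentImage J I ψ x) i).2).choose_spec

theorem isFrame_orthonormalFrame (ψ : M → N) (x : M) :
    IsFrame (mfderiv I J ψ x : TangentSpace I x →ₗ[ℝ] TangentSpace J (ψ x))
      (orthonormalFrame J I ψ x) := by
  have hf : (fun i => (mfderiv I J ψ x : TangentSpace I x →ₗ[ℝ] TangentSpace J (ψ x))
      (orthonormalFrame J I ψ x i)) =
      (tangentImage J I ψ x).subtype ∘ stdOrthonormalBasis ℝ (tangentImage J I ψ x) :=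
    funext fun i => mfderiv_orthonormalFrame J I ψ x i
  constructor
  · rw [hf]
    exact (stdOrthonormalBasis ℝ (tangentImage J I ψ x)).orthonormal.comp_linearIsometry
      (tangentImage J I ψ x).subtypeₗᵢ
  · rw [hf, Set.range_comp, ← Submodule.map_span, ← OrthonormalBasis.coe_toBasis,
      Module.Basis.span_eq, Submodule.map_subtype_top]
    rfl

variable [IsManifold J ∞ N] [IsManifold I ∞ M]

/-- A submanifold whose second fundamental form is proportional to its metric is totally
umbilical. -/
theorem isTotallyUmbilical_of_exists {ψ : M → N}
    (h : ∀ x : M, ∃ T : TangentSpace J (ψ x), ∀ u v : TangentSpace I x,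
      secondFundamentalForm J I ψ x u v = inducedMetric J I ψ x u v • T) :
    IsTotallyUmbilical J I ψ := by
  intro x u v
  obtain ⟨T, hT⟩ := h x
  -- In dimension zero the mean curvature need not equal `T`, but the metric vanishes; otherwise
  -- averaging h over a unit frame recovers `T`.
  rcases Nat.eq_zero_or_pos (Module.finrank ℝ (tangentImage J I ψ x)) with h0 | hpos
  · have hm : mfderiv I J ψ x u = 0 := by
      have : mfderiv I J ψ x u ∈ tangentImage J I ψ x := ⟨u, rfl⟩
      rwa [Submodule.finrank_eq_zero.1 h0, Submodule.mem_bot] at this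
    rw [hT, inducedMetric, hm, inner_zero_left, zero_smul, zero_smul]
  · have hH : meanCurvature J I ψ x = T := by
      have hi : ∀ i, inducedMetric J I ψ x (orthonormalFrame J I ψ x i)
          (orthonormalFrame J I ψ x i) = 1 := fun i => by
        rw [inducedMetric, real_inner_self_eq_norm_sq,
          show ‖mfderiv I J ψ x (orthonormalFrame J I ψ x i)‖ = 1 from
            (isFrame_orthonormalFrame J I ψ x).orthonormal.1 i, one_pow]
      rw [meanCurvature]
      simp only [hT, hi, one_smul, Finset.sum_const, Finset.card_univ, Fintype.card_fin]
      rw [← Nat.cast_smul_eq_nsmul ℝ, smul_smul,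
        inv_mul_cancel₀ (Nat.cast_ne_zero.2 hpos.ne'), one_smul]
    rw [hH, hT]

end Frame

theorem starProjection_congr {V : Type*} [NormedAddCommGroup V] [InnerProductSpace ℝ V]
    {S T : Submodule ℝ V} [S.HasOrthogonalProjection] [T.HasOrthogonalProjection] (h : S = T)
    (v : V) : S.starProjection v = T.starProjection v := by
  subst h
  rfl

/-! ### The second order data of a semi-slant warped product -/

section SemiSlant

variable {E₁ : Type*} [NormedAddCommGroup E₁] [NormedSpace ℝ E₁] [FiniteDimensional ℝ E₁]
  {H₁ : Type*} [TopologicalSpace H₁] (I₁ : ModelWithCorners ℝ E₁ H₁) [I₁.Boundaryless]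
  {M₁ : Type*} [TopologicalSpace M₁] [ChartedSpace H₁ M₁] [IsManifold I₁ ∞ M₁]
  [RiemannianBundle (fun p : M₁ => TangentSpace I₁ p)]
  [IsContMDiffRiemannianBundle I₁ ∞ E₁ (fun p : M₁ => TangentSpace I₁ p)]
  {E₂ : Type*} [NormedAddCommGroup E₂] [NormedSpace ℝ E₂] [FiniteDimensional ℝ E₂]
  {H₂ : Type*} [TopologicalSpace H₂] (I₂ : ModelWithCorners ℝ E₂ H₂) [I₂.Boundaryless]
  {M₂ : Type*} [TopologicalSpace M₂] [ChartedSpace H₂ M₂] [IsManifold I₂ ∞ M₂]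
  [RiemannianBundle (fun q : M₂ => TangentSpace I₂ q)]
  [IsContMDiffRiemannianBundle I₂ ∞ E₂ (fun q : M₂ => TangentSpace I₂ q)]
  {F : Type*} [NormedAddCommGroup F] [NormedSpace ℝ F] [FiniteDimensional ℝ F]
  {H : Type*} [TopologicalSpace H] (J : ModelWithCorners ℝ F H) [J.Boundaryless]
  {N : Type*} [TopologicalSpace N] [ChartedSpace H N] [IsManifold J ∞ N]
  [RiemannianBundle (fun y : N => TangentSpace J y)]
  [IsContMDiffRiemannianBundle J ∞ F (fun y : N => TangentSpace J y)]
  {f : M₁ → ℝ} {ψ : M₁ × M₂ → N}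
  {φ : ∀ y : N, TangentSpace J y →L[ℝ] TangentSpace J y}
  {ξ : ∀ y : N, TangentSpace J y} {η : ∀ y : N, TangentSpace J y →L[ℝ] ℝ} {θ : ℝ}

/-- The Hessian of a map as a bilinear map. -/
def hessianForm {E : Type*} [NormedAddCommGroup E] [NormedSpace ℝ E]
    {H' : Type*} [TopologicalSpace H'] (I : ModelWithCorners ℝ E H') [I.Boundaryless]
    {M : Type*} [TopologicalSpace M] [ChartedSpace H' M] [IsManifold I ∞ M] {ψ : M → N}
    (hψ : ContMDiff I J ∞ ψ) (x : M) :
    TangentSpace I x →ₗ[ℝ] TangentSpace I x →ₗ[ℝ] TangentSpace J (ψ x) :=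
  LinearMap.mk₂ ℝ (mapHessian J I ψ x) (mapHessian_add_left J I hψ x)
    (mapHessian_smul_left J I hψ x)
    (fun u v v' => by
      rw [mapHessian_comm J I hψ, mapHessian_add_left J I hψ, mapHessian_comm J I hψ x v,
        mapHessian_comm J I hψ x v'])
    (fun c u v => by
      rw [mapHessian_comm J I hψ, mapHessian_smul_left J I hψ, mapHessian_comm J I hψ x v])

theorem tangentImage_slice_left (hψ : ContMDiff (I₁.prod I₂) J ∞ ψ) (p : M₁) (q : M₂) :
    tangentImage J I₁ (fun p => ψ (p, q)) p =
      LinearMap.range ((mfderiv (I₁.prod I₂) J ψ (p, q)).toLinearMap ∘ₗ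
        (inlTangent I₁ I₂ p q).toLinearMap) :=
  congrArg LinearMap.range (LinearMap.ext fun v => mfderiv_slice_left I₁ I₂ J hψ p q v)

theorem tangentImage_slice_right (hψ : ContMDiff (I₁.prod I₂) J ∞ ψ) (p : M₁) (q : M₂) :
    tangentImage J I₂ (fun q => ψ (p, q)) q =
      LinearMap.range ((mfderiv (I₁.prod I₂) J ψ (p, q)).toLinearMap ∘ₗ
        (inrTangent I₁ I₂ p q).toLinearMap) :=
  congrArg LinearMap.range (LinearMap.ext fun v => mfderiv_slice_right I₁ I₂ J hψ p q v)

theorem IsProperWarpedProductSemiSlant.isSemiSlantHessian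
    (hM : IsProperWarpedProductSemiSlant I₁ I₂ J φ ξ θ f ψ) (hN : IsKenmotsu J φ ξ η)
    (p : M₁) (q : M₂) :
    IsSemiSlantHessian (φ (ψ (p, q))).toLinearMap (ξ (ψ (p, q))) θ (f p)
      (gradient I₁ (fun p => Real.log (f p)) p) (inlTangent I₁ I₂ p q).toLinearMap
      (inrTangent I₁ I₂ p q).toLinearMap (mfderiv (I₁.prod I₂) J ψ (p, q)).toLinearMap
      (hessianForm J (I₁.prod I₂) hM.smooth (p, q)) where
  inner_phi_phi v w := by
    have := hN.inner_phi_phi (ψ (p, q)) v w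
    rwa [hN.eta_eq, hN.eta_eq] at this
  inner_xi_xi := by rw [← hN.eta_eq, hN.eta_xi]
  inner_phi_left := hN.inner_phi_left _
  exists_add u := ⟨_, _, inlTangent_add_inrTangent I₁ I₂ p q u⟩
  pos := hM.pos_f p
  inner_inl_inl := hM.inner_inl_inl I₁ I₂ J p q
  inner_inl_inr := hM.inner_inl_inr I₁ I₂ J p q
  inner_inr_inr := hM.inner_inr_inr I₁ I₂ J p q
  exists_xi_eq := hM.exists_xi_eq I₁ I₂ J p q
  exists_phi_eq := hM.exists_phi_eq I₁ I₂ J p q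
  slant b hb := by
    have hmem : mfderiv (I₁.prod I₂) J ψ (p, q) (inrTangent I₁ I₂ p q b) ∈
        tangentImage J I₂ (fun q => ψ (p, q)) q := ⟨b, mfderiv_slice_right I₁ I₂ J hM.smooth p q b⟩
    -- The slant condition excludes multiples of `ξ`; a nonzero vector of M_θ is not one, being
    -- orthogonal to `ξ`.
    have h := hM.slant p q _ hmem (fun hspan => by
      obtain ⟨r, hr⟩ := Submodule.mem_span_singleton.1 hspan
      have h₁ := hM.inner_inr_inr I₁ I₂ J p q b b
      rw [← hr, real_inner_smul_left, hr, hM.inner_xi_inr I₁ I₂ J, mul_zero] at h₁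
      exact mul_ne_zero (pow_ne_zero 2 (hM.pos_f p).ne') (inner_self_ne_zero.2 hb) h₁.symm)
    rw [starProjection_congr (tangentImage_slice_right I₁ I₂ J hM.smooth p q)] at h
    exact h
  theta_pos := hM.theta_pos
  theta_lt := hM.theta_lt
  symm := mapHessian_comm J _ hM.smooth (p, q)
  inner_inl_inl_inr := hM.inner_mapHessian_inl_inl_inr I₁ I₂ J p q
  inner_inl_inr_inr := hM.inner_mapHessian_inl_inr_inr I₁ I₂ J p q
  inner_inr_inr_inl := hM.inner_mapHessian_inr_inr_inl I₁ I₂ J p q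
  inner_phi_inr := hM.inner_mapHessian_phi I₁ I₂ J hN p q
  inner_gradient_xi _ hb _ ha := hM.inner_gradient_xi I₁ I₂ J hN p q hb ha

theorem secondFundamentalFormNormSq_eq_sum (hψ : ContMDiff (I₁.prod I₂) J ∞ ψ) (x : M₁ × M₂) :
    secondFundamentalFormNormSq J (I₁.prod I₂) ψ x =
      ∑ i, ∑ j, ‖IsSemiSlantHessian.sff (mfderiv (I₁.prod I₂) J ψ x).toLinearMap
        (hessianForm J (I₁.prod I₂) hψ x) (orthonormalFrame J (I₁.prod I₂) ψ x i)
        (orthonormalFrame J (I₁.prod I₂) ψ x j)‖ ^ 2 := by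
  rw [secondFundamentalFormNormSq]
  simp only [real_inner_self_eq_norm_sq]
  rfl

/-- The lower bound `2 n (csc² θ + cot² θ) (‖grad ln f‖² - 1)` of the squared norm of the second
fundamental form, `n` being the dimension of the slant factor. -/
theorem IsProperWarpedProductSemiSlant.le_secondFundamentalFormNormSq
    (hM : IsProperWarpedProductSemiSlant I₁ I₂ J φ ξ θ f ψ) (hN : IsKenmotsu J φ ξ η)
    (x : M₁ × M₂) :
    2 * (Module.finrank ℝ E₂ : ℝ) * ((Real.sin θ)⁻¹ ^ 2 + Real.cot θ ^ 2) *
      (‖gradient I₁ (fun p => Real.log (f p)) x.1‖ ^ 2 - 1) ≤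
        secondFundamentalFormNormSq J (I₁.prod I₂) ψ x := by
  rw [secondFundamentalFormNormSq_eq_sum I₁ I₂ J hM.smooth]
  exact (hM.isSemiSlantHessian I₁ I₂ J hN x.1 x.2).le_sum_norm_sq_sff
    (isFrame_orthonormalFrame J (I₁.prod I₂) ψ x)

/-! ### The equality case for the submanifold -/

section Equality

variable (hM : IsProperWarpedProductSemiSlant I₁ I₂ J φ ξ θ f ψ) (hN : IsKenmotsu J φ ξ η)
  (heq : ∀ x : M₁ × M₂, secondFundamentalFormNormSq J (I₁.prod I₂) ψ x =
    2 * (Module.finrank ℝ E₂ : ℝ) * ((Real.sin θ)⁻¹ ^ 2 + Real.cot θ ^ 2) *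
      (‖gradient I₁ (fun p => Real.log (f p)) x.1‖ ^ 2 - 1))
include hM hN heq

theorem IsProperWarpedProductSemiSlant.isTotallyGeodesic_of_eq (q : M₂) :
    IsTotallyGeodesic J I₁ (fun p => ψ (p, q)) := by
  intro p u v
  have heq' := heq (p, q)
  rw [secondFundamentalFormNormSq_eq_sum I₁ I₂ J hM.smooth] at heq'
  have hm : mapHessian J I₁ (fun p => ψ (p, q)) p u v ∈
      tangentImage J I₁ (fun p => ψ (p, q)) p := by
    rw [tangentImage_slice_left I₁ I₂ J hM.smooth p q, mapHessian_slice_left I₁ I₂ J hM.smooth p q]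
    exact (hM.isSemiSlantHessian I₁ I₂ J hN p q).hessian_inl_mem
      (isFrame_orthonormalFrame J (I₁.prod I₂) ψ (p, q)) heq' u v
  refine (Submodule.starProjection_apply_eq_zero_iff _).2 ?_
  rw [Submodule.orthogonal_orthogonal]
  exact hm

theorem IsProperWarpedProductSemiSlant.isTotallyUmbilical_of_eq (p : M₁) :
    IsTotallyUmbilical J I₂ (fun q => ψ (p, q)) := by
  -- The witness is −∇ ln f, the mean curvature vector that M_θ already has inside M.
  refine isTotallyUmbilical_of_exists J I₂ fun q => ⟨-mfderiv (I₁.prod I₂) J ψ (p, q)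
    (inlTangent I₁ I₂ p q (gradient I₁ (fun p => Real.log (f p)) p)), fun u v => ?_⟩
  have heq' := heq (p, q)
  rw [secondFundamentalFormNormSq_eq_sum I₁ I₂ J hM.smooth] at heq'
  rw [inducedMetric, mfderiv_slice_right I₁ I₂ J hM.smooth p q,
    mfderiv_slice_right I₁ I₂ J hM.smooth p q]
  refine Eq.trans ?_ ((hM.isSemiSlantHessian I₁ I₂ J hN p q).starProjection_hessian_inr
    (isFrame_orthonormalFrame J (I₁.prod I₂) ψ (p, q)) heq' u v)
  refine (starProjection_congr (congrArg _
    (tangentImage_slice_right I₁ I₂ J hM.smooth p q)) _).trans ?_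
  exact congrArg _ (mapHessian_slice_right I₁ I₂ J hM.smooth p q u v)

theorem IsProperWarpedProductSemiSlant.isMinimal_of_eq : IsMinimal J (I₁.prod I₂) ψ := by
  intro x
  have heq' := heq x
  rw [secondFundamentalFormNormSq_eq_sum I₁ I₂ J hM.smooth] at heq'
  rw [meanCurvature, smul_eq_zero]
  exact Or.inr ((hM.isSemiSlantHessian I₁ I₂ J hN x.1 x.2).trace_sff_eq_zero
    (isFrame_orthonormalFrame J (I₁.prod I₂) ψ x) heq')

end Equality

end SemiSlant

end KenmotsuGeometry

end

theorem theorem3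
    -- the ambient manifold
    {F : Type*} [NormedAddCommGroup F] [NormedSpace ℝ F] [FiniteDimensional ℝ F]
    {N : Type*} [TopologicalSpace N] [ChartedSpace F N] [IsManifold 𝓘(ℝ, F) ∞ N]
    [RiemannianBundle (fun y : N => TangentSpace 𝓘(ℝ, F) y)]
    [IsContMDiffRiemannianBundle 𝓘(ℝ, F) ∞ F (fun y : N => TangentSpace 𝓘(ℝ, F) y)]
    (φ : ∀ y : N, TangentSpace 𝓘(ℝ, F) y →L[ℝ] TangentSpace 𝓘(ℝ, F) y)
    (ξ : ∀ y : N, TangentSpace 𝓘(ℝ, F) y) (η : ∀ y : N, TangentSpace 𝓘(ℝ, F) y →L[ℝ] ℝ)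
    (hN : KenmotsuGeometry.IsKenmotsu 𝓘(ℝ, F) φ ξ η)
    -- the Riemannian manifolds `M_T` and `M_θ`
    {E₁ : Type*} [NormedAddCommGroup E₁] [NormedSpace ℝ E₁] [FiniteDimensional ℝ E₁]
    {MT : Type*} [TopologicalSpace MT] [ChartedSpace E₁ MT] [IsManifold 𝓘(ℝ, E₁) ∞ MT]
    [RiemannianBundle (fun p : MT => TangentSpace 𝓘(ℝ, E₁) p)]
    [IsContMDiffRiemannianBundle 𝓘(ℝ, E₁) ∞ E₁ (fun p : MT => TangentSpace 𝓘(ℝ, E₁) p)]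
    {E₂ : Type*} [NormedAddCommGroup E₂] [NormedSpace ℝ E₂] [FiniteDimensional ℝ E₂]
    {Mθ : Type*} [TopologicalSpace Mθ] [ChartedSpace E₂ Mθ] [IsManifold 𝓘(ℝ, E₂) ∞ Mθ]
    [RiemannianBundle (fun q : Mθ => TangentSpace 𝓘(ℝ, E₂) q)]
    [IsContMDiffRiemannianBundle 𝓘(ℝ, E₂) ∞ E₂ (fun q : Mθ => TangentSpace 𝓘(ℝ, E₂) q)]
    (s : ℕ) (hs : Module.finrank ℝ E₂ = 2 * s)
    -- the warped product submanifold `M = M_T ×_f M_θ`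
    (θ : ℝ) (f : MT → ℝ) (ψ : MT × Mθ → N)
    (hM : KenmotsuGeometry.IsProperWarpedProductSemiSlant 𝓘(ℝ, E₁) 𝓘(ℝ, E₂) 𝓘(ℝ, F) φ ξ θ f ψ) :
    (∀ x : MT × Mθ,
      KenmotsuGeometry.secondFundamentalFormNormSq 𝓘(ℝ, F) (𝓘(ℝ, E₁).prod 𝓘(ℝ, E₂)) ψ x ≥
        4 * (s : ℝ) * ((Real.sin θ)⁻¹ ^ 2 + Real.cot θ ^ 2) *
          (‖KenmotsuGeometry.gradient 𝓘(ℝ, E₁) (fun p => Real.log (f p)) x.1‖ ^ 2 - 1)) ∧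
    ((∀ x : MT × Mθ,
      KenmotsuGeometry.secondFundamentalFormNormSq 𝓘(ℝ, F) (𝓘(ℝ, E₁).prod 𝓘(ℝ, E₂)) ψ x =
        4 * (s : ℝ) * ((Real.sin θ)⁻¹ ^ 2 + Real.cot θ ^ 2) *
          (‖KenmotsuGeometry.gradient 𝓘(ℝ, E₁) (fun p => Real.log (f p)) x.1‖ ^ 2 - 1)) →
      (∀ q : Mθ, KenmotsuGeometry.IsTotallyGeodesic 𝓘(ℝ, F) 𝓘(ℝ, E₁) (fun p : MT => ψ (p, q))) ∧
      (∀ p : MT, KenmotsuGeometry.IsTotallyUmbilical 𝓘(ℝ, F) 𝓘(ℝ, E₂) (fun q : Mθ => ψ (p, q))) ∧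
      KenmotsuGeometry.IsMinimal 𝓘(ℝ, F) (𝓘(ℝ, E₁).prod 𝓘(ℝ, E₂)) ψ) := by
  have hdim : 4 * (s : ℝ) = 2 * (Module.finrank ℝ E₂ : ℝ) := by
    rw [hs]
    push_cast
    ring
  simp only [hdim]
  exact ⟨fun x => hM.le_secondFundamentalFormNormSq _ _ _ hN x, fun heq =>
    ⟨hM.isTotallyGeodesic_of_eq _ _ _ hN heq, hM.isTotallyUmbilical_of_eq _ _ _ hN heq,
      hM.isMinimal_of_eq _ _ _ hN heq⟩⟩
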